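/- Consider parking with screening on the lattice of sites $(x,r)$ with positions $x\in\{-2,-1,0,1,2\}$ and layers $r=1,2,3,\dots$. All sites are initially empty. Particles arrive at the positions $-1,0,1$ according to independent Poisson processes with a common rate $\lambda>0$, and no particles arrive at $\pm2$. A particle arriving at position $x$ is deposited at $(x,h)$, where $h=1+\max\{r : \text{some site } (y,r) \text{ with } |y-x|\le 1 \text{ is occupied at the moment of arrival}\}$ (with $\max\emptyset=0$). Let $\kappa_t(x,r)\in\{0,1\}$ be the occupancy of the site $(x,r)$ at time $t$, let $\rho_t(x,r)=\mathbb{E}\,\kappa_t(x,r)$ be its density, and let $\rho_\infty(x,r)=\lim_{t\to\infty}\rho_t(x,r)$ be its end-density. Theorem 2. The end-densities exist, and the end-density of the centre position converges as the layer tends to infinity: $$p_0:=\lim_{r\to\infty}\rho_\infty(0,r)=\frac{10-\sqrt5}{19}\approx 0.408628 .$$ The same holds for the neighbouring positions: the limits $p_{\pm1}:=\lim_{r\to\infty}\rho_\infty(\pm1,r)$ exist and $$p_{-1}=p_1=p_0=\frac{10-\sqrt5}{19}.$$ -/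

import Mathlib

open MeasureTheory ProbabilityTheory Filter Topology
open scoped NNReal

/-- The horizontal positions `-2, -1, 0, 1, 2` of the lattice. -/
abbrev Position : Type := ↥(Finset.Icc (-2 : ℤ) 2)

/-- A configuration: the finite set of occupied lattice sites `(x, r)`
(position `x`, layer `r`; the lowest layer is `r = 1`). -/
abbrev Configuration : Type := Finset (Position × ℕ)

/-- The layer at which a particle arriving at `x` is deposited:
`1 + max {r : some (y, r) with |y - x| ≤ 1 is occupied}`, where the maximum is `0` if there is no
such `r` (the supremum of an empty finset of naturals is `0`). -/
def depositLayer (C : Configuration) (x : Position) : ℕ :=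
  1 + (C.filter fun p => |(p.1 : ℤ) - (x : ℤ)| ≤ 1).sup Prod.snd

/-- `N` is a (homogeneous) Poisson process of rate `lam` under `μ`. -/
structure IsPoissonProcess {Ω : Type*} [MeasurableSpace Ω] (N : ℝ≥0 → Ω → ℕ) (lam : ℝ≥0)
    (μ : Measure Ω) : Prop where
  measurable : ∀ t, Measurable (N t)
  zero : ∀ᵐ ω ∂μ, N 0 ω = 0
  monotone : ∀ᵐ ω ∂μ, Monotone fun t => N t ω
  right_continuous : ∀ᵐ ω ∂μ, ∀ t, ContinuousWithinAt (fun s => N s ω) (Set.Ici t) t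
  law_increment : ∀ s t, s ≤ t →
    HasLaw (fun ω => N t ω - N s ω) (poissonMeasure (lam * (t - s))) μ
  indep_increments : HasIndepIncrements N μ

/-- The arrival processes of the model: independent Poisson processes with common rate `lam` at the
positions `-1, 0, 1`, and no arrivals at the boundary positions `-2` and `2`. -/
structure IsArrivalProcess {Ω : Type*} [MeasurableSpace Ω] (N : Position → ℝ≥0 → Ω → ℕ)
    (lam : ℝ≥0) (μ : Measure Ω) : Prop where
  poisson : ∀ x : Position, |(x : ℤ)| ≤ 1 → IsPoissonProcess (N x) lam μ
  boundary : ∀ x : Position, |(x : ℤ)| = 2 → ∀ t ω, N x t ω = 0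
  indep : iIndepFun (fun (x : Position) (ω : Ω) (t : ℝ≥0) => N x t ω) μ

section Deposition

/-- The total number of arrivals up to time `t`, for counting paths `n`. -/
noncomputable def totalArrivals (n : Position → ℝ≥0 → ℕ) (t : ℝ≥0) : ℕ :=
  ∑ x : Position, n x t

/-- The time of the `k`-th arrival among all positions (time `0` for `k = 0`). -/
noncomputable def arrivalTime (n : Position → ℝ≥0 → ℕ) (k : ℕ) : ℝ≥0 :=
  sInf {t : ℝ≥0 | k ≤ totalArrivals n t}

/-- The configuration after the first `k` arrivals. Initially all sites are empty; the `(k+1)`-st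
particle arrives at the position whose counting path increases between the `k`-th and the
`(k+1)`-st arrival time (almost surely there is exactly one such position), and it is deposited
according to `depositLayer`. -/
noncomputable def configAfter (n : Position → ℝ≥0 → ℕ) : ℕ → Configuration
  | 0 => ∅
  | k + 1 => configAfter n k ∪
      (Finset.univ.filter fun x : Position =>
        n x (arrivalTime n k) < n x (arrivalTime n (k + 1))).image
        fun x => (x, depositLayer (configAfter n k) x)

/-- The configuration at time `t`. -/
noncomputable def configAt (n : Position → ℝ≥0 → ℕ) (t : ℝ≥0) : Configuration :=
  configAfter n (totalArrivals n t)

end Deposition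

/-- The occupancy `κ_t(x, r)`: `1` if there is a particle at `(x, r)` at time `t`, else `0`. -/
noncomputable def occupancy {Ω : Type*} (N : Position → ℝ≥0 → Ω → ℕ)
    (t : ℝ≥0) (x : Position) (r : ℕ) (ω : Ω) : ℝ :=
  if (x, r) ∈ configAt (fun y s => N y s ω) t then 1 else 0

/-- The time-dependent density `ρ_t(x, r)`, the expectation of the occupancy. -/
noncomputable def density {Ω : Type*} [MeasurableSpace Ω] (N : Position → ℝ≥0 → Ω → ℕ)
    (μ : Measure Ω) (t : ℝ≥0) (x : Position) (r : ℕ) : ℝ :=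
  ∫ ω, occupancy N t x r ω ∂μ

/-! A particle arriving at `0` is screened by every occupied site, so it lands strictly above
everything and erases the past. If it lands at layer `M` and is followed by `a` arrivals at `1` and
`b` at `-1`, these two columns grow independently of each other up to `M + a` and `M + b`, and the
next arrival at `0` lands at `M + max a b + 1`. Since successive arrivals are uniform on the three
positions, the layers occupied at `0` form a renewal process with gap `1 + max a b`, where `(a, b)`
has probability `(a + b).choose a / 3 ^ (a + b + 1)` (`centreVisits_succ`). The mean gap is `2 + 1 /
√5` (`hasSum_pairWeight_max`), and the renewal theorem `tendsto_renewal` gives the limit `(10 - √5)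
/ 19`, its inverse.

A particle at `(1, r)` is the `(a + 1)`-st one at `1` after a renewal at layer `r - a - 1`. Between
renewals at least `a + 1` arrivals at `1` occur with probability `2 ^ -(a + 1)`, so the density at
`1` is a geometric average of densities at `0` (`occLimit_side`) and has the same limit; reflection
handles `-1`.

Continuous time enters only through the number of arrivals. Cut `[0, t]` into `m` slots: when no
slot has two arrivals, the configuration is an explicit function of the slot pattern. Letting `m`
and then `t` tend to infinity identifies the end-density with the probability that the site is ever
occupied (`IsArrivalProcess.tendsto_real_occEvent`). -/

/-! ### The discrete renewal theorem. -/

section Renewal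

/-- The tail sums of a summable nonnegative sequence add up to its mean. -/
lemma hasSum_tail_of_hasSum_mean {f : ℕ → ℝ} {m : ℝ} (hf0 : ∀ n, 0 ≤ f n) (hsum : HasSum f 1)
    (hmean : HasSum (fun n : ℕ => ((n : ℝ) + 1) * f n) m) :
    HasSum (fun j => 1 - ∑ i ∈ Finset.range j, f i) m := by
  -- Double counting of `f i` over the pairs `j ≤ i`: rows give the mean, columns the tails.
  set g : ℕ × ℕ → ℝ := fun q => if q.2 ≤ q.1 then f q.1 else 0 with hg
  have hrow : ∀ i, HasSum (fun j => g (i, j)) (((i : ℝ) + 1) * f i) := by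
    intro i
    have h := hasSum_sum_of_ne_finset_zero (L := .unconditional ℕ) (f := fun j => g (i, j)) (s := Finset.range (i + 1))
      (by intro j hj; simp only [Finset.mem_range] at hj; simp only [hg]; rw [if_neg]; omega)
    convert h using 1
    rw [Finset.sum_congr rfl (g := fun _ => f i)]
    · simp
    · intro j hj
      simp only [Finset.mem_range] at hj
      simp only [hg]
      rw [if_pos]; omega
  have hgs : Summable g := by
    rw [summable_prod_of_nonneg]
    · exact ⟨fun i => (hrow i).summable, by simpa only [(hrow _).tsum_eq] using hmean.summable⟩
    · intro q; simp only [hg, Pi.zero_apply]; split_ifs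
      · exact hf0 _
      · exact le_rfl
  have hgm : HasSum g m := by
    have := hgs.hasSum.prod_fiberwise hrow
    rw [hmean.unique this]; exact hgs.hasSum
  have hcol : ∀ j, HasSum (fun i => g (i, j)) (1 - ∑ i ∈ Finset.range j, f i) := by
    intro j
    have h1 : HasSum (fun i => if i ∈ Finset.range j then f i else 0)
        (∑ i ∈ Finset.range j, if i ∈ Finset.range j then f i else 0) :=
      hasSum_sum_of_ne_finset_zero fun i hi => if_neg hi
    rw [Finset.sum_congr rfl fun i hi => if_pos hi] at h1
    have h2 : HasSum (fun i => f i - if i ∈ Finset.range j then f i else 0)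
        (1 - ∑ i ∈ Finset.range j, f i) := hsum.sub h1
    refine h2.congr_fun fun i => ?_
    simp only [hg, Finset.mem_range]
    by_cases h : j ≤ i
    · simp [h, not_lt.2 h]
    · simp [h, not_le.1 h]
  have hsw : HasSum (g ∘ Equiv.prodComm ℕ ℕ) m := (Equiv.hasSum_iff (Equiv.prodComm ℕ ℕ)).2 hgm
  exact HasSum.prod_fiberwise hsw hcol

/-- A sequence that satisfies an averaging identity and is extremal at `0` is constant. -/
lemma eq_of_averaging {f v : ℕ → ℝ} (hf0 : ∀ n, 0 ≤ f n) (hf1 : 0 < f 0) (hsum : HasSum f 1)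
    (hv : ∀ j, HasSum (fun i => f i * v (j + 1 + i)) (v j)) (hle : ∀ i, v i ≤ v 0) (j : ℕ) :
    v j = v 0 := by
  induction j with
  | zero => rfl
  | succ j ih =>
    have h : HasSum (fun i => f i * (v 0 - v (j + 1 + i))) 0 := by
      have := (hsum.mul_right (v 0)).sub (hv j)
      simpa [ih, mul_sub] using this
    have h0 := (hasSum_zero_iff_of_nonneg
      (fun i => mul_nonneg (hf0 i) (sub_nonneg.2 (hle _)))).1 h
    -- All terms of this vanishing nonnegative sum vanish; as `f 0 > 0`, the term `i = 0` gives the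
    -- next value of `v`.
    have := congrFun h0 0
    simp only [Pi.zero_apply, mul_eq_zero, hf1.ne', false_or, add_zero] at this
    linarith

variable {f u : ℕ → ℝ} {m : ℝ}

lemma renewal_mem_Icc (hf0 : ∀ n, 0 ≤ f n) (hsum : HasSum f 1) (hu0 : u 0 = 1)
    (hu : ∀ n, u (n + 1) = ∑ j ∈ Finset.range (n + 1), f j * u (n - j)) (n : ℕ) :
    u n ∈ Set.Icc (0 : ℝ) 1 := by
  induction n using Nat.strong_induction_on with
  | _ n ih =>
    cases n with
    | zero => simp [hu0]
    | succ n =>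
      rw [hu]
      constructor
      · exact Finset.sum_nonneg fun j hj => mul_nonneg (hf0 j) (ih _ (by omega)).1
      · calc _ ≤ ∑ j ∈ Finset.range (n + 1), f j :=
              Finset.sum_le_sum fun j hj =>
                mul_le_of_le_one_right (hf0 j) (ih _ (by omega)).2
          _ ≤ 1 := sum_le_hasSum _ (fun i _ => hf0 i) hsum

/-- Decomposition by the last renewal at or before `n`: it is at `n - j`, and the following gap
exceeds `j`. -/
lemma renewal_sum_tail (hu0 : u 0 = 1)
    (hu : ∀ n, u (n + 1) = ∑ j ∈ Finset.range (n + 1), f j * u (n - j)) (n : ℕ) :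
    ∑ j ∈ Finset.range (n + 1), (1 - ∑ i ∈ Finset.range j, f i) * u (n - j) = 1 := by
  induction n with
  | zero => simp [hu0]
  | succ n ih =>
    rw [Finset.sum_range_succ']
    simp only [Finset.range_zero, Finset.sum_empty, sub_zero, one_mul]
    rw [Nat.sub_zero, hu n, ← Finset.sum_add_distrib]
    refine Eq.trans (Finset.sum_congr rfl fun j _ => ?_) ih
    rw [Finset.sum_range_succ, Nat.add_sub_add_right]
    ring

/-- Limits `v j` of the backward shifts of `u` inherit the renewal equation as an averaging
identity. Extremality of `v 0 = x` forces `v` to be constant, and the tail identity then reads `m *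
x = 1`. -/
lemma renewal_cluster_eq (hf0 : ∀ n, 0 ≤ f n) (hf1 : 0 < f 0) (hsum : HasSum f 1)
    (hmean : HasSum (fun n : ℕ => ((n : ℝ) + 1) * f n) m) (hu0 : u 0 = 1)
    (hu : ∀ n, u (n + 1) = ∑ j ∈ Finset.range (n + 1), f j * u (n - j)) {x : ℝ}
    (hx : MapClusterPt x atTop u)
    (hext : (∀ y, MapClusterPt y atTop u → y ≤ x) ∨ (∀ y, MapClusterPt y atTop u → x ≤ y)) :
    x = m⁻¹ := by
  have hb := renewal_mem_Icc hf0 hsum hu0 hu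
  have hT := hasSum_tail_of_hasSum_mean hf0 hsum hmean
  have hT0 : ∀ j, 0 ≤ 1 - ∑ i ∈ Finset.range j, f i := fun j =>
    sub_nonneg.2 (sum_le_hasSum _ (fun i _ => hf0 i) hsum)
  have hnorm : ∀ n, ‖u n‖ ≤ 1 := fun n => by
    rw [Real.norm_eq_abs, abs_of_nonneg (hb n).1]; exact (hb n).2
  -- Along an ultrafilter all shifts of `u` converge at once, by compactness of `[0, 1]`; no
  -- diagonal subsequence is needed.
  obtain ⟨𝒰, h𝒰, hxU⟩ := mapClusterPt_iff_ultrafilter.1 hx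
  have hsub : ∀ j : ℕ, Tendsto (fun n => n - j) (𝒰 : Filter ℕ) atTop := fun j =>
    (tendsto_sub_atTop_nat j).mono_left h𝒰
  have hlim : ∀ j : ℕ, ∃ y, Tendsto (fun n => u (n - j)) 𝒰 (𝓝 y) := by
    intro j
    obtain ⟨y, -, hy⟩ := isCompact_Icc.ultrafilter_le_nhds (𝒰.map fun n => u (n - j))
      (by
        rw [le_principal_iff]
        exact Filter.Eventually.of_forall (f := (𝒰 : Filter ℕ)) fun n => hb (n - j))
    exact ⟨y, hy⟩
  choose v hv using hlim
  have hv0 : v 0 = x := tendsto_nhds_unique (by simpa using hv 0) hxU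
  have hcl : ∀ j, MapClusterPt (v j) atTop u := fun j =>
    MapClusterPt.of_comp (φ := fun n => n - j) (p := (𝒰 : Filter ℕ)) (hsub j)
      (hv j).mapClusterPt
  have hlarge : ∀ j : ℕ, ∀ᶠ n in (𝒰 : Filter ℕ), j ≤ n := fun j => h𝒰 (eventually_ge_atTop j)
  have havg : ∀ j, HasSum (fun i => f i * v (j + 1 + i)) (v j) := by
    intro j
    have hlim := tendsto_tsum_of_dominated_convergence (𝓕 := (𝒰 : Filter ℕ)) (bound := f)
      (f := fun n i => if i ∈ Finset.range (n - j) then f i * u (n - (j + 1 + i)) else 0)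
      (g := fun i => f i * v (j + 1 + i)) hsum.summable
      (fun i => by
        refine ((hv (j + 1 + i)).const_mul (f i)).congr' ?_
        filter_upwards [hlarge (j + i + 1)] with n hn
        rw [if_pos (Finset.mem_range.2 (by omega))])
      (Eventually.of_forall fun n i => by
        split_ifs
        · rw [norm_mul, Real.norm_eq_abs, abs_of_nonneg (hf0 i)]
          exact mul_le_of_le_one_right (hf0 i) (hnorm _)
        · simpa using hf0 i)
    have heq : v j = ∑' i, f i * v (j + 1 + i) := by
      refine tendsto_nhds_unique (hv j) (hlim.congr' ?_)
      filter_upwards [hlarge (j + 1)] with n hn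
      rw [tsum_eq_sum (s := Finset.range (n - j)) (fun i hi => if_neg hi)]
      obtain ⟨k, rfl⟩ : ∃ k, n = k + 1 + j := ⟨n - j - 1, by omega⟩
      rw [Nat.add_sub_cancel, hu]
      refine Finset.sum_congr rfl fun i hi => ?_
      rw [if_pos hi]
      congr 2
      omega
    rw [heq]
    refine (Summable.of_norm_bounded hsum.summable fun i => ?_).hasSum
    rw [norm_mul, Real.norm_eq_abs, abs_of_nonneg (hf0 i)]
    exact mul_le_of_le_one_right (hf0 i) (le_of_tendsto (hv _).norm (Eventually.of_forall
      fun n => hnorm _))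
  have hconst : ∀ j, v j = x := by
    intro j
    rcases hext with h | h
    · rw [← hv0]
      exact eq_of_averaging hf0 hf1 hsum havg (fun i => hv0 ▸ h _ (hcl i)) j
    · have := eq_of_averaging (v := fun i => -v i) hf0 hf1 hsum
        (fun j => by simpa using (havg j).neg) (fun i => neg_le_neg (hv0 ▸ h _ (hcl i))) j
      rw [← hv0]
      linarith
  have hone : (1 : ℝ) = ∑' j, (1 - ∑ i ∈ Finset.range j, f i) * v j := by
    have hlim := tendsto_tsum_of_dominated_convergence (𝓕 := (𝒰 : Filter ℕ))
      (bound := fun j => 1 - ∑ i ∈ Finset.range j, f i)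
      (f := fun n j => if j ∈ Finset.range (n + 1) then
        (1 - ∑ i ∈ Finset.range j, f i) * u (n - j) else 0)
      (g := fun j => (1 - ∑ i ∈ Finset.range j, f i) * v j) hT.summable
      (fun j => by
        refine ((hv j).const_mul _).congr' ?_
        filter_upwards [hlarge j] with n hn
        rw [if_pos (Finset.mem_range.2 (by omega))])
      (Eventually.of_forall fun n j => by
        split_ifs
        · rw [norm_mul, Real.norm_eq_abs, abs_of_nonneg (hT0 j)]
          exact mul_le_of_le_one_right (hT0 j) (hnorm _)
        · simpa using hT0 j)
    refine tendsto_nhds_unique (tendsto_const_nhds.congr fun n => ?_) hlim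
    rw [tsum_eq_sum (s := Finset.range (n + 1)) (fun i hi => if_neg hi)]
    exact ((Finset.sum_congr rfl fun i hi => if_pos hi).trans (renewal_sum_tail hu0 hu n)).symm
  simp only [hconst] at hone
  rw [(hT.mul_right x).tsum_eq] at hone
  exact eq_inv_of_mul_eq_one_right hone.symm

/-- The renewal theorem for a gap law `f` (where `f n` is the probability of the gap `n + 1`) that
charges the gap `1` and has finite mean `m`. -/
theorem tendsto_renewal (hf0 : ∀ n, 0 ≤ f n) (hf1 : 0 < f 0) (hsum : HasSum f 1)
    (hmean : HasSum (fun n : ℕ => ((n : ℝ) + 1) * f n) m) (hu0 : u 0 = 1)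
    (hu : ∀ n, u (n + 1) = ∑ j ∈ Finset.range (n + 1), f j * u (n - j)) :
    Tendsto u atTop (𝓝 m⁻¹) := by
  have hb := renewal_mem_Icc hf0 hsum hu0 hu
  have hba : IsBoundedUnder (· ≤ ·) atTop u := isBoundedUnder_of ⟨1, fun n => (hb n).2⟩
  have hbb : IsBoundedUnder (· ≥ ·) atTop u := isBoundedUnder_of ⟨0, fun n => (hb n).1⟩
  have hs := isGreatest_mapClusterPt_limsup (hbb.isCoboundedUnder_le) hba
  have hi := isLeast_mapClusterPt_liminf (hba.isCoboundedUnder_ge) hbb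
  refine tendsto_of_le_liminf_of_limsup_le ?_ ?_ hba hbb
  · exact (renewal_cluster_eq hf0 hf1 hsum hmean hu0 hu hi.1 (Or.inr fun y hy => hi.2 hy)).ge
  · exact (renewal_cluster_eq hf0 hf1 hsum hmean hu0 hu hs.1 (Or.inl fun y hy => hs.2 hy)).le

end Renewal

/-! ### The law and the mean of the gap. -/

section GapLaw

/-- The probability that exactly `q.1` and `q.2` particles arrive at the positions `1` and `-1`
before the next arrival at `0`. -/
noncomputable def pairWeight (q : ℕ × ℕ) : ℝ := (q.1 + q.2).choose q.1 / 3 ^ (q.1 + q.2 + 1)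

lemma pairWeight_nonneg (q : ℕ × ℕ) : 0 ≤ pairWeight q := by
  unfold pairWeight; positivity

/-- The binomially weighted sum of `φ` over the `n`-th antidiagonal. -/
noncomputable def chooseSum (φ : ℕ → ℕ → ℝ) (n : ℕ) : ℝ :=
  ∑ q ∈ Finset.HasAntidiagonal.antidiagonal n, (n.choose q.1 : ℝ) * φ q.1 q.2

lemma chooseSum_succ (φ : ℕ → ℕ → ℝ) (n : ℕ) :
    chooseSum φ (n + 1) = chooseSum (fun a b => φ a (b + 1) + φ (a + 1) b) n := by
  simp only [chooseSum]
  rw [Finset.sum_antidiagonal_choose_succ_mul, ← Finset.sum_add_distrib]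
  refine Finset.sum_congr rfl fun q hq => ?_
  rw [Finset.HasAntidiagonal.mem_antidiagonal] at hq
  rw [← Nat.choose_symm_of_eq_add hq.symm]
  ring

lemma chooseSum_one (n : ℕ) : chooseSum (fun _ _ => 1) n = 2 ^ n := by
  induction n with
  | zero => simp [chooseSum]
  | succ n ih =>
    rw [chooseSum_succ, pow_succ, ← ih]
    simp only [chooseSum, Finset.sum_mul]
    exact Finset.sum_congr rfl fun q _ => by ring

lemma hasSum_prod_of_antidiagonal {g : ℕ × ℕ → ℝ} {s : ℝ} (hg : ∀ q, 0 ≤ g q)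
    (h : HasSum (fun n => ∑ q ∈ Finset.HasAntidiagonal.antidiagonal n, g q) s) : HasSum g s := by
  rw [← Finset.HasAntidiagonal.sigmaAntidiagonalEquivProd.hasSum_iff]
  have hfib : ∀ n, HasSum (fun q : Finset.HasAntidiagonal.antidiagonal n => g q)
      (∑ q ∈ Finset.HasAntidiagonal.antidiagonal n, g q) := fun n => Finset.hasSum _ _
  have hsm : Summable (g ∘ Finset.HasAntidiagonal.sigmaAntidiagonalEquivProd) := by
    refine (summable_sigma_of_nonneg fun q => hg _).2 ⟨fun n => (hfib n).summable, ?_⟩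
    refine h.summable.congr fun n => ?_
    exact (hfib n).tsum_eq.symm
  have h2 := hsm.hasSum.sigma (fun n => hfib n)
  rw [h.unique h2]
  exact hsm.hasSum

/-- Summation of `φ` against the weights, given a solution `ψ` of the associated Poisson equation
of at most linear growth. -/
lemma hasSum_pairWeight {φ ψ : ℕ → ℕ → ℝ} (hφ : ∀ a b, 0 ≤ φ a b) (hψ0 : ∀ a b, 0 ≤ ψ a b)
    (hψ : ∀ a b, ψ a b ≤ a + b + 3)
    (h : ∀ a b, 3 * ψ a b - (ψ a (b + 1) + ψ (a + 1) b) = φ a b) :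
    HasSum (fun q : ℕ × ℕ => pairWeight q * φ q.1 q.2) (ψ 0 0) := by
  refine hasSum_prod_of_antidiagonal (fun q => mul_nonneg (pairWeight_nonneg q) (hφ _ _)) ?_
  -- By Pascal's rule the Poisson equation makes the antidiagonal sums telescope; the remainder is
  -- at most `(n + 3) * (2 / 3) ^ n`.
  have hsum : ∀ n, ∑ q ∈ Finset.HasAntidiagonal.antidiagonal n, pairWeight q * φ q.1 q.2
      = chooseSum ψ n / 3 ^ n - chooseSum ψ (n + 1) / 3 ^ (n + 1) := by
    intro n
    rw [chooseSum_succ]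
    simp only [chooseSum, Finset.sum_div]
    rw [← Finset.sum_sub_distrib]
    refine Finset.sum_congr rfl fun q hq => ?_
    rw [Finset.HasAntidiagonal.mem_antidiagonal] at hq
    rw [pairWeight, hq, ← h]
    field_simp
    ring
  rw [hasSum_iff_tendsto_nat_of_nonneg fun n => Finset.sum_nonneg fun q _ =>
    mul_nonneg (pairWeight_nonneg q) (hφ _ _)]
  simp only [hsum, Finset.sum_range_sub']
  have h0 : chooseSum ψ 0 / 3 ^ 0 = ψ 0 0 := by simp [chooseSum]
  rw [h0]
  suffices Tendsto (fun n => chooseSum ψ n / 3 ^ n) atTop (𝓝 0) by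
    simpa using this.const_sub (ψ 0 0)
  have hgeo : Tendsto (fun n : ℕ => (n : ℝ) * (2 / 3 : ℝ) ^ n + 3 * (2 / 3 : ℝ) ^ n) atTop
      (𝓝 0) := by
    simpa using (tendsto_self_mul_const_pow_of_lt_one (by norm_num) (by norm_num)).add
      ((tendsto_pow_atTop_nhds_zero_of_lt_one (r := (2 / 3 : ℝ)) (by norm_num)
        (by norm_num)).const_mul 3)
  refine squeeze_zero (fun n => ?_) (fun n => ?_) hgeo
  · exact div_nonneg (Finset.sum_nonneg fun q _ => mul_nonneg (by positivity) (hψ0 _ _))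
      (by positivity)
  · have : chooseSum ψ n ≤ (n + 3) * 2 ^ n := by
      rw [← chooseSum_one, chooseSum, chooseSum, Finset.mul_sum]
      refine Finset.sum_le_sum fun q hq => ?_
      rw [Finset.HasAntidiagonal.mem_antidiagonal] at hq
      have h1 := hψ q.1 q.2
      rw [show (q.1 : ℝ) + q.2 = n by exact_mod_cast hq] at h1
      nlinarith [(Nat.cast_nonneg (n.choose q.1) : (0 : ℝ) ≤ _)]
    rw [← add_mul, div_pow, ← mul_div_assoc]
    gcongr

lemma hasSum_pairWeight_one : HasSum pairWeight 1 := by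
  have := hasSum_pairWeight (φ := fun _ _ => 1) (ψ := fun _ _ => 1) (by simp) (by simp)
    (fun a b => by have : (0 : ℝ) ≤ a + b := by positivity
                   linarith) (by norm_num)
  simpa using this

/-- The smaller root of `z ^ 2 = 3 * z - 1`. -/
noncomputable def decayRatio : ℝ := (3 - √5) / 2

lemma decayRatio_sq : decayRatio ^ 2 = 3 * decayRatio - 1 := by
  have := Real.sq_sqrt (show (0 : ℝ) ≤ 5 by norm_num)
  unfold decayRatio; nlinarith

lemma sqrt_five_bounds : 2.236 < √5 ∧ √5 < 2.237 :=
  ⟨Real.lt_sqrt_of_sq_lt (by norm_num), (Real.sqrt_lt' (by norm_num)).2 (by norm_num)⟩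

/-- The expectation of `1 + max` of the final numbers of arrivals at `1` and `-1`, if so far there
have been `a` and `b` of them. -/
noncomputable def expectedGap (a b : ℕ) : ℝ :=
  (max a b : ℕ) + 2 + decayRatio ^ (max a b - min a b) / √5

/-- Off the diagonal `max a b + 2` solves the equation alone, and the powers of `decayRatio` cancel
since it is a root of `z ^ 2 = 3 * z - 1`. On the diagonal a defect of `1` remains, and `3 - 2 *
decayRatio = √5` fixes the coefficient `1 / √5`. -/
lemma expectedGap_eq (a b : ℕ) :
    3 * expectedGap a b - (expectedGap a (b + 1) + expectedGap (a + 1) b) =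
      ((max a b : ℕ) : ℝ) + 1 := by
  have h5 : √5 ≠ 0 := by positivity
  have hsq := Real.sq_sqrt (show (0 : ℝ) ≤ 5 by norm_num)
  rcases lt_trichotomy a b with h | rfl | h
  · obtain ⟨d, rfl⟩ : ∃ d, b = a + d + 1 := ⟨b - a - 1, by omega⟩
    have e1 : max a (a + d + 1) = a + d + 1 := by omega
    have e2 : max a (a + d + 1) - min a (a + d + 1) = d + 1 := by omega
    have e3 : max a (a + d + 1 + 1) = a + d + 2 := by omega
    have e4 : max a (a + d + 1 + 1) - min a (a + d + 1 + 1) = d + 2 := by omega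
    have e5 : max (a + 1) (a + d + 1) = a + d + 1 := by omega
    have e6 : max (a + 1) (a + d + 1) - min (a + 1) (a + d + 1) = d := by omega
    unfold expectedGap
    rw [e2, e4, e6, e1, e3, e5, pow_add, pow_add, decayRatio_sq]
    push_cast
    field_simp
    ring
  · have e3 : max a (a + 1) = a + 1 := by omega
    have e4 : max a (a + 1) - min a (a + 1) = 1 := by omega
    have e5 : max (a + 1) a = a + 1 := by omega
    have e6 : max (a + 1) a - min (a + 1) a = 1 := by omega
    unfold expectedGap
    rw [e4, e6, e3, e5, max_self, min_self, Nat.sub_self, decayRatio]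
    push_cast
    field_simp
    nlinarith
  · obtain ⟨d, rfl⟩ : ∃ d, a = b + d + 1 := ⟨a - b - 1, by omega⟩
    have e1 : max (b + d + 1) b = b + d + 1 := by omega
    have e2 : max (b + d + 1) b - min (b + d + 1) b = d + 1 := by omega
    have e3 : max (b + d + 1 + 1) b = b + d + 2 := by omega
    have e4 : max (b + d + 1 + 1) b - min (b + d + 1 + 1) b = d + 2 := by omega
    have e5 : max (b + d + 1) (b + 1) = b + d + 1 := by omega
    have e6 : max (b + d + 1) (b + 1) - min (b + d + 1) (b + 1) = d := by omega
    unfold expectedGap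
    rw [e2, e4, e6, e1, e3, e5, pow_add, pow_add, decayRatio_sq]
    push_cast
    field_simp
    ring

lemma hasSum_pairWeight_max :
    HasSum (fun q : ℕ × ℕ => pairWeight q * (((max q.1 q.2 : ℕ) : ℝ) + 1)) (2 + 1 / √5) := by
  obtain ⟨hl, hu⟩ := sqrt_five_bounds
  have h0 : 0 ≤ decayRatio := by unfold decayRatio; linarith
  have h1 : decayRatio ≤ 1 := by unfold decayRatio; linarith
  have := hasSum_pairWeight (φ := fun a b => ((max a b : ℕ) : ℝ) + 1) (ψ := expectedGap)
    (fun a b => by positivity) (fun a b => by unfold expectedGap; positivity)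
    (fun a b => by
      have h2 : ((max a b : ℕ) : ℝ) ≤ a + b := by
        exact_mod_cast max_le (Nat.le_add_right a b) (Nat.le_add_left b a)
      have h3 : decayRatio ^ (max a b - min a b) / √5 ≤ 1 := by
        rw [div_le_one (by positivity)]
        exact (pow_le_one₀ h0 h1).trans (by linarith)
      unfold expectedGap
      linarith)
    expectedGap_eq
  simpa [expectedGap] using this

/-- The pairs of natural numbers with maximum `j`. -/
def maxFiber (j : ℕ) : Finset (ℕ × ℕ) :=
  (Finset.range (j + 1) ×ˢ Finset.range (j + 1)).filter fun q => max q.1 q.2 = j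

lemma mem_maxFiber {j : ℕ} {q : ℕ × ℕ} : q ∈ maxFiber j ↔ max q.1 q.2 = j := by
  simp only [maxFiber, Finset.mem_filter, Finset.mem_product, Finset.mem_range]
  omega

lemma hasSum_maxFiber {g : ℕ × ℕ → ℝ} {s : ℝ} (hg : HasSum g s) :
    HasSum (fun j => ∑ q ∈ maxFiber j, g q) s := by
  have h := hg.tsum_fiberwise fun q => max q.1 q.2
  refine h.congr_fun fun j => ?_
  have hset : (fun q : ℕ × ℕ => max q.1 q.2) ⁻¹' {j} = ↑(maxFiber j) := by
    ext q; simp [mem_maxFiber]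
  rw [hset]
  exact (Finset.tsum_subtype (maxFiber j) g).symm

/-- The probability that two consecutive arrivals at `0` are deposited at layers with difference
`j + 1`. -/
noncomputable def gapLaw (j : ℕ) : ℝ := ∑ q ∈ maxFiber j, pairWeight q

lemma gapLaw_nonneg (j : ℕ) : 0 ≤ gapLaw j := Finset.sum_nonneg fun q _ => pairWeight_nonneg q

lemma gapLaw_zero_pos : 0 < gapLaw 0 := by
  refine Finset.sum_pos' (fun q _ => pairWeight_nonneg q) ⟨(0, 0), mem_maxFiber.2 rfl, ?_⟩
  norm_num [pairWeight]

lemma hasSum_gapLaw : HasSum gapLaw 1 := hasSum_maxFiber hasSum_pairWeight_one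

lemma hasSum_gapLaw_mean : HasSum (fun n : ℕ => ((n : ℝ) + 1) * gapLaw n) (2 + 1 / √5) := by
  refine (hasSum_maxFiber hasSum_pairWeight_max).congr_fun fun j => ?_
  rw [gapLaw, Finset.mul_sum]
  refine Finset.sum_congr rfl fun q hq => ?_
  rw [mem_maxFiber.1 hq, mul_comm]

lemma inv_gapMean : (2 + 1 / √5 : ℝ)⁻¹ = (10 - √5) / 19 := by
  have h5 : 0 < √5 := by positivity
  have hsq := Real.sq_sqrt (show (0 : ℝ) ≤ 5 by norm_num)
  rw [inv_eq_iff_eq_inv, inv_div, eq_div_iff (by nlinarith)]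
  field_simp
  nlinarith

end GapLaw

/-! ### Markov operators with three equally likely steps. -/

section MarkovOperator

variable {S S' : Type*}

/-- The Markov operator of the chain that makes one of three steps with equal probabilities. -/
noncomputable def avgStep (step : Fin 3 → S → S) : (S → ℝ) →ₗ[ℝ] (S → ℝ) where
  toFun f s := (∑ i, f (step i s)) / 3
  map_add' f g := by
    funext s
    simp only [Pi.add_apply, Finset.sum_add_distrib, add_div]
  map_smul' c f := by
    funext s
    simp only [Pi.smul_apply, smul_eq_mul, ← Finset.mul_sum, RingHom.id_apply, mul_div_assoc]

lemma avgStep_apply (step : Fin 3 → S → S) (f : S → ℝ) (s : S) :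
    avgStep step f s = (f (step 0 s) + f (step 1 s) + f (step 2 s)) / 3 := by
  simp [avgStep, Fin.sum_univ_three]

lemma avgStep_mono (step : Fin 3 → S → S) : Monotone (avgStep step) := fun f g h s => by
  rw [avgStep_apply, avgStep_apply]
  have h0 := h (step 0 s)
  have h1 := h (step 1 s)
  have h2 := h (step 2 s)
  linarith

lemma avgStep_pow_mono (step : Fin 3 → S → S) (n : ℕ) : Monotone ⇑(avgStep step ^ n) := by
  rw [Module.End.coe_pow]
  exact (avgStep_mono step).iterate n

lemma avgStep_pow_nonneg (step : Fin 3 → S → S) {f : S → ℝ} (hf : 0 ≤ f) (n : ℕ) (s : S) :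
    0 ≤ (avgStep step ^ n) f s := by
  have := avgStep_pow_mono step n hf s
  rwa [map_zero] at this

lemma avgStep_pow_one (step : Fin 3 → S → S) (n : ℕ) :
    (avgStep step ^ n) (fun _ => (1 : ℝ)) = fun _ => 1 := by
  rw [Module.End.coe_pow]
  refine Function.iterate_fixed ?_ n
  funext s
  rw [avgStep_apply]; norm_num

lemma avgStep_pow_le_one (step : Fin 3 → S → S) {f : S → ℝ} (hf : f ≤ fun _ => 1) (n : ℕ) (s : S) :
    (avgStep step ^ n) f s ≤ 1 := by
  have := avgStep_pow_mono step n hf s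
  rwa [avgStep_pow_one] at this

/-- Lumping: a relation preserved by the steps transfers expectations from one chain to another. -/
lemma avgStep_pow_congr {step : Fin 3 → S → S} {step' : Fin 3 → S' → S'} {R : S → S' → Prop}
    (hR : ∀ s t, R s t → ∀ i, R (step i s) (step' i t)) {f : S → ℝ} {g : S' → ℝ}
    (hfg : ∀ s t, R s t → f s = g t) (n : ℕ) {s : S} {t : S'} (hst : R s t) :
    (avgStep step ^ n) f s = (avgStep step' ^ n) g t := by
  induction n generalizing s t with
  | zero => exact hfg s t hst
  | succ n ih =>
    simp only [pow_succ', Module.End.mul_apply, avgStep_apply]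
    rw [ih (hR s t hst 0), ih (hR s t hst 1), ih (hR s t hst 2)]

/-- Dynkin's formula: the expected total change is the sum of the expected one-step changes. -/
lemma avgStep_pow_sub (step : Fin 3 → S → S) (f : S → ℝ) (n : ℕ) (s : S) :
    ∑ k ∈ Finset.range n, (avgStep step ^ k) (avgStep step f - f) s
      = (avgStep step ^ n) f s - f s := by
  induction n with
  | zero => simp
  | succ n ih =>
    rw [Finset.sum_range_succ, ih, map_sub, ← Module.End.mul_apply, ← pow_succ, Pi.sub_apply]
    ring

end MarkovOperator

/-! ### The configuration as a Markov chain indexed by the number of arrivals. -/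

section ConfigurationChain

/-- The positions `-1, 0, 1` at which particles arrive. -/
def arrivalPos (i : Fin 3) : Position := ⟨(i : ℤ) - 1, by rw [Finset.mem_Icc]; omega⟩

lemma arrivalPos_injective : Function.Injective arrivalPos := fun i j h => by
  have h' : (i : ℤ) - 1 = (j : ℤ) - 1 := congrArg Subtype.val h
  exact Fin.ext (by omega)

lemma abs_arrivalPos_le (i : Fin 3) : |(arrivalPos i : ℤ)| ≤ 1 := by
  simp only [arrivalPos, abs_le]; omega

lemma abs_eq_two_or_exists_arrivalPos (x : Position) :
    |(x : ℤ)| = 2 ∨ ∃ i, arrivalPos i = x := by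
  obtain ⟨x, hx⟩ := x
  rw [Finset.mem_Icc] at hx
  by_cases h : |x| = 2
  · exact Or.inl h
  · right
    have h1 : 0 ≤ x + 1 ∧ x + 1 < 3 := by
      rcases abs_cases x with h' | h' <;> omega
    refine ⟨⟨(x + 1).toNat, by omega⟩, Subtype.ext ?_⟩
    simp only [arrivalPos]
    omega

/-- The configuration after one more arrival at `x`. -/
def deposit (C : Configuration) (x : Position) : Configuration :=
  insert (x, depositLayer C x) C

lemma depositLayer_insert (C : Configuration) (x y : Position) (k : ℕ) :
    depositLayer (insert (x, k) C) y =
      if |(x : ℤ) - (y : ℤ)| ≤ 1 then max (1 + k) (depositLayer C y) else depositLayer C y := by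
  unfold depositLayer
  rw [Finset.filter_insert]
  split_ifs with h
  · rw [Finset.sup_insert, ← max_add_add_left]
  · rfl

lemma lt_depositLayer {C : Configuration} {x : Position} {r : ℕ} (h : (x, r) ∈ C) :
    r < depositLayer C x := by
  have : r ≤ (C.filter fun p => |(p.1 : ℤ) - (x : ℤ)| ≤ 1).sup Prod.snd :=
    Finset.le_sup (f := Prod.snd) (b := (x, r)) (Finset.mem_filter.2 ⟨h, by simp⟩)
  unfold depositLayer
  omega

/-- The step of the configuration chain at an arrival at the `i`-th position. -/
def configStep (i : Fin 3) (C : Configuration) : Configuration := deposit C (arrivalPos i)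

/-- The indicator of the occupancy of a site. -/
noncomputable def occInd (x : Position) (r : ℕ) (C : Configuration) : ℝ :=
  if (x, r) ∈ C then 1 else 0

lemma occInd_nonneg (x : Position) (r : ℕ) : 0 ≤ occInd x r := fun C => by
  unfold occInd; split_ifs <;> simp

lemma occInd_le_one (x : Position) (r : ℕ) : occInd x r ≤ fun _ => 1 := fun C => by
  unfold occInd; split_ifs <;> simp

lemma occInd_le_configStep (x : Position) (r : ℕ) (i : Fin 3) (C : Configuration) :
    occInd x r C ≤ occInd x r (configStep i C) := by
  unfold occInd configStep deposit
  by_cases h : (x, r) ∈ C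
  · rw [if_pos h, if_pos (Finset.mem_insert_of_mem h)]
  · rw [if_neg h]; split_ifs <;> simp

lemma occInd_le_avgStep (x : Position) (r : ℕ) : occInd x r ≤ avgStep configStep (occInd x r) :=
  fun C => by
    rw [avgStep_apply]
    have h0 := occInd_le_configStep x r 0 C
    have h1 := occInd_le_configStep x r 1 C
    have h2 := occInd_le_configStep x r 2 C
    linarith

/-- A deposit is strictly above its own column, so a site is filled at most once and its occupancy
counts the deposits there. -/
lemma occInd_configStep (i j : Fin 3) (r : ℕ) (C : Configuration) :
    occInd (arrivalPos i) r (configStep j C) = occInd (arrivalPos i) r C +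
      if j = i then (if depositLayer C (arrivalPos i) = r then 1 else 0) else 0 := by
  unfold occInd configStep deposit
  by_cases h : (arrivalPos i, r) ∈ C
  · have := lt_depositLayer h
    rw [if_pos (Finset.mem_insert_of_mem h), if_pos h, if_neg (by omega : ¬ _ = r)]
    simp
  · rw [if_neg h]
    simp only [Finset.mem_insert, h, or_false, Prod.mk.injEq, arrivalPos_injective.eq_iff]
    by_cases hij : j = i
    · subst hij; simp [eq_comm]
    · simp [hij, Ne.symm hij]

/-- The probability that the site `(x, r)` is occupied after `n` arrivals. -/
noncomputable def occProb (x : Position) (r n : ℕ) : ℝ :=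
  (avgStep configStep ^ n) (occInd x r) ∅

lemma occProb_nonneg (x : Position) (r n : ℕ) : 0 ≤ occProb x r n :=
  avgStep_pow_nonneg _ (occInd_nonneg x r) n _

lemma occProb_le_one (x : Position) (r n : ℕ) : occProb x r n ≤ 1 :=
  avgStep_pow_le_one _ (occInd_le_one x r) n _

lemma occProb_mono (x : Position) (r : ℕ) : Monotone (occProb x r) := by
  refine monotone_nat_of_le_succ fun n => ?_
  unfold occProb
  rw [pow_succ, Module.End.mul_apply]
  exact avgStep_pow_mono _ n (occInd_le_avgStep x r) ∅

/-- The probability that the site `(x, r)` is ever occupied. -/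
noncomputable def occLimit (x : Position) (r : ℕ) : ℝ := ⨆ n, occProb x r n

lemma bddAbove_occProb (x : Position) (r : ℕ) : BddAbove (Set.range (occProb x r)) :=
  ⟨1, by rintro _ ⟨n, rfl⟩; exact occProb_le_one x r n⟩

lemma tendsto_occProb (x : Position) (r : ℕ) :
    Tendsto (occProb x r) atTop (𝓝 (occLimit x r)) :=
  tendsto_atTop_ciSup (occProb_mono x r) (bddAbove_occProb x r)

lemma occProb_le_occLimit (x : Position) (r n : ℕ) : occProb x r n ≤ occLimit x r :=
  le_ciSup (bddAbove_occProb x r) n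

end ConfigurationChain

/-! ### Reduction to three coordinates and the renewal structure. -/

section LayerChain

/-- The step of the reduced chain. In the state `(M, a, b)` the last arrival at `0` was deposited at
the layer `M`, and since then there were `a` arrivals at `1` and `b` arrivals at `-1`. -/
def layerStep (i : Fin 3) (s : ℕ × ℕ × ℕ) : ℕ × ℕ × ℕ :=
  ![(s.1, s.2.1, s.2.2 + 1), (s.1 + max s.2.1 s.2.2 + 1, 0, 0), (s.1, s.2.1 + 1, s.2.2)] i

/-- The layer at which the next particle at the `i`-th position is deposited. -/
def nextLayer (i : Fin 3) (s : ℕ × ℕ × ℕ) : ℕ :=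
  ![s.1 + s.2.2 + 1, s.1 + max s.2.1 s.2.2 + 1, s.1 + s.2.1 + 1] i

/-- The positions `-1` and `1` are at distance two and do not screen each other, while `0` screens
both; hence three numbers determine all deposit layers. -/
lemma depositLayer_configStep {C : Configuration} {s : ℕ × ℕ × ℕ}
    (h : ∀ j, depositLayer C (arrivalPos j) = nextLayer j s) (i j : Fin 3) :
    depositLayer (configStep i C) (arrivalPos j) = nextLayer j (layerStep i s) := by
  unfold configStep deposit
  rw [depositLayer_insert, h, h]
  fin_cases i <;> fin_cases j <;> simp [arrivalPos, nextLayer, layerStep] <;> omega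

/-- The indicator of the states in which the next particle at the `i`-th position is deposited at
the layer `r`. -/
noncomputable def layerInd (i : Fin 3) (r : ℕ) (s : ℕ × ℕ × ℕ) : ℝ :=
  if nextLayer i s = r then 1 else 0

lemma layerInd_nonneg (i : Fin 3) (r : ℕ) : 0 ≤ layerInd i r := fun s => by
  unfold layerInd; split_ifs <;> simp

lemma avgStep_occInd_sub (i : Fin 3) (r : ℕ) (C : Configuration) :
    (avgStep configStep (occInd (arrivalPos i) r) - occInd (arrivalPos i) r) C =
      (if depositLayer C (arrivalPos i) = r then 1 else 0) / 3 := by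
  rw [Pi.sub_apply, avgStep_apply]
  simp only [occInd_configStep]
  fin_cases i <;> simp <;> ring

/-- The probability of the event `f` after `n` steps of the reduced chain. -/
noncomputable def layerProb (f : ℕ × ℕ × ℕ → ℝ) (n : ℕ) : ℝ := (avgStep layerStep ^ n) f 0

/-- The expected number of visits of the reduced chain. -/
noncomputable def visits (f : ℕ × ℕ × ℕ → ℝ) : ℝ := ∑' n, layerProb f n

lemma layerProb_mono {f g : ℕ × ℕ × ℕ → ℝ} (h : f ≤ g) (n : ℕ) : layerProb f n ≤ layerProb g n :=
  avgStep_pow_mono _ n h 0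

lemma layerProb_nonneg {f : ℕ × ℕ × ℕ → ℝ} (h : 0 ≤ f) (n : ℕ) : 0 ≤ layerProb f n :=
  avgStep_pow_nonneg _ h n 0

lemma layerProb_add (f g : ℕ × ℕ × ℕ → ℝ) (n : ℕ) :
    layerProb (f + g) n = layerProb f n + layerProb g n := by
  simp [layerProb]

lemma layerProb_smul (c : ℝ) (f : ℕ × ℕ × ℕ → ℝ) (n : ℕ) :
    layerProb (c • f) n = c * layerProb f n := by
  simp [layerProb]

lemma layerProb_sum {ι : Type*} (s : Finset ι) (f : ι → ℕ × ℕ × ℕ → ℝ) (n : ℕ) :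
    layerProb (∑ i ∈ s, f i) n = ∑ i ∈ s, layerProb (f i) n := by
  simp [layerProb]

lemma layerProb_succ (f : ℕ × ℕ × ℕ → ℝ) (n : ℕ) :
    layerProb f (n + 1) = layerProb (avgStep layerStep f) n := by
  simp [layerProb, pow_succ]

/-- A site is filled at most once, so the probability that it is ever filled is the sum over `n` of
the probability that the next arrival fills it. That arrival has the right position with probability
`1 / 3`, whence the factor `3`. -/
lemma hasSum_layerProb_layerInd (i : Fin 3) (r : ℕ) :
    HasSum (layerProb (layerInd i r)) (3 * occLimit (arrivalPos i) r) := by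
  rw [hasSum_iff_tendsto_nat_of_nonneg fun n => layerProb_nonneg (layerInd_nonneg i r) n]
  refine ((tendsto_occProb (arrivalPos i) r).const_mul 3).congr fun n => ?_
  have h := avgStep_pow_sub configStep (occInd (arrivalPos i) r) n ∅
  have h0 : occInd (arrivalPos i) r ∅ = 0 := by simp [occInd]
  rw [h0, sub_zero] at h
  rw [occProb, ← h, Finset.mul_sum]
  refine Finset.sum_congr rfl fun k _ => ?_
  rw [avgStep_pow_congr (step' := layerStep) (g := (1 / 3 : ℝ) • layerInd i r)
    (R := fun C s => ∀ j, depositLayer C (arrivalPos j) = nextLayer j s) (t := 0)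
    (fun C s h i j => depositLayer_configStep h i j)
    (fun C s h => by
      rw [avgStep_occInd_sub, h i, Pi.smul_apply, layerInd, smul_eq_mul]; ring) k
    (fun j => by fin_cases j <;> simp [depositLayer, nextLayer])]
  rw [map_smul, Pi.smul_apply, smul_eq_mul, layerProb]
  ring

lemma layerInd_zero (i : Fin 3) : layerInd i 0 = 0 := by
  funext s
  fin_cases i <;> simp [layerInd, nextLayer]

lemma summable_layerProb {f : ℕ × ℕ × ℕ → ℝ} {i : Fin 3} {r : ℕ} (h0 : 0 ≤ f)
    (h : f ≤ layerInd i r) : Summable (layerProb f) := by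
  refine Summable.of_nonneg_of_le (layerProb_nonneg h0) (layerProb_mono h) ?_
  exact (hasSum_layerProb_layerInd i r).summable

lemma visits_layerInd (i : Fin 3) (r : ℕ) :
    visits (layerInd i r) = 3 * occLimit (arrivalPos i) r :=
  (hasSum_layerProb_layerInd i r).tsum_eq

lemma visits_smul (c : ℝ) (f : ℕ × ℕ × ℕ → ℝ) : visits (c • f) = c * visits f := by
  simp only [visits, layerProb_smul, tsum_mul_left]

lemma visits_add {f g : ℕ × ℕ × ℕ → ℝ} (hf : Summable (layerProb f))
    (hg : Summable (layerProb g)) : visits (f + g) = visits f + visits g := by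
  simp only [visits, layerProb_add]
  exact hf.tsum_add hg

lemma visits_sum {ι : Type*} (s : Finset ι) {f : ι → ℕ × ℕ × ℕ → ℝ}
    (hf : ∀ i ∈ s, Summable (layerProb (f i))) :
    visits (∑ i ∈ s, f i) = ∑ i ∈ s, visits (f i) := by
  simp only [visits, layerProb_sum]
  exact Summable.tsum_finsetSum hf

/-- Splitting off time `0`. For an indicator, `avgStep` weighs the predecessor states, so this is a
backward recursion for expected visits. -/
lemma visits_eq_add {f : ℕ × ℕ × ℕ → ℝ} (hf : Summable (layerProb f)) :
    visits f = f 0 + visits (avgStep layerStep f) := by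
  rw [visits, hf.tsum_eq_zero_add]
  simp only [layerProb_succ]
  rfl

/-- The indicator of a state. -/
noncomputable def stateInd (s t : ℕ × ℕ × ℕ) : ℝ := if t = s then 1 else 0

/-- The indicator of the states with given first two entries. -/
noncomputable def rowInd (M a : ℕ) (t : ℕ × ℕ × ℕ) : ℝ := if t.1 = M ∧ t.2.1 = a then 1 else 0

/-- Throughout the row the next particle at `1` would land at the same site, so `summable_layerProb`
applies. -/
lemma summable_rowInd (M a : ℕ) : Summable (layerProb (rowInd M a)) :=
  summable_layerProb (i := 2) (r := M + a + 1)
    (fun t => by unfold rowInd; split_ifs <;> simp)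
    (fun t => by
      unfold rowInd layerInd
      by_cases h : t.1 = M ∧ t.2.1 = a
      · rw [if_pos h, if_pos (by simp [nextLayer, h])]
      · rw [if_neg h]; split_ifs <;> simp)

lemma summable_stateInd (s : ℕ × ℕ × ℕ) : Summable (layerProb (stateInd s)) :=
  summable_layerProb (i := 2) (r := nextLayer 2 s)
    (fun t => by unfold stateInd; split_ifs <;> simp)
    (fun t => by
      unfold stateInd layerInd
      by_cases h : t = s
      · rw [if_pos h, if_pos (by rw [h])]
      · rw [if_neg h]; split_ifs <;> simp)

lemma avgStep_stateInd_zero (M : ℕ) :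
    avgStep layerStep (stateInd (M, 0, 0)) = (1 / 3 : ℝ) • layerInd 1 M := by
  funext t
  rw [avgStep_apply]
  by_cases h : t.1 + max t.2.1 t.2.2 + 1 = M <;>
    simp [stateInd, layerStep, layerInd, nextLayer, Prod.ext_iff, h]

lemma avgStep_stateInd_succ_zero (M a : ℕ) :
    avgStep layerStep (stateInd (M, a + 1, 0)) = (1 / 3 : ℝ) • stateInd (M, a, 0) := by
  funext t
  rw [avgStep_apply]
  simp [stateInd, layerStep, Prod.ext_iff]
  split_ifs <;> norm_num

lemma avgStep_stateInd_zero_succ (M b : ℕ) :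
    avgStep layerStep (stateInd (M, 0, b + 1)) = (1 / 3 : ℝ) • stateInd (M, 0, b) := by
  funext t
  rw [avgStep_apply]
  simp [stateInd, layerStep, Prod.ext_iff]
  split_ifs <;> norm_num

lemma avgStep_stateInd_succ_succ (M a b : ℕ) :
    avgStep layerStep (stateInd (M, a + 1, b + 1)) =
      (1 / 3 : ℝ) • (stateInd (M, a + 1, b) + stateInd (M, a, b + 1)) := by
  funext t
  rw [avgStep_apply]
  simp [stateInd, layerStep, Prod.ext_iff]
  split_ifs <;> norm_num

lemma avgStep_rowInd_zero (M : ℕ) :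
    avgStep layerStep (rowInd M 0) = (1 / 3 : ℝ) • (rowInd M 0 + layerInd 1 M) := by
  funext t
  rw [avgStep_apply]
  by_cases h : t.1 + max t.2.1 t.2.2 + 1 = M <;> by_cases h' : t.1 = M ∧ t.2.1 = 0 <;>
    simp [rowInd, layerStep, layerInd, nextLayer, h, h'] <;> ring

lemma avgStep_rowInd_succ (M a : ℕ) :
    avgStep layerStep (rowInd M (a + 1)) = (1 / 3 : ℝ) • (rowInd M (a + 1) + rowInd M a) := by
  funext t
  rw [avgStep_apply]
  by_cases h : t.1 = M ∧ t.2.1 = a + 1 <;> by_cases h' : t.1 = M ∧ t.2.1 = a <;>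
    simp [rowInd, layerStep, h, h']

/-- The probability that some arrival at `0` is deposited at the layer `M`, where the ground counts
as the layer `0`. -/
noncomputable def centreVisits (M : ℕ) : ℝ := visits (stateInd (M, 0, 0))

lemma centreVisits_eq (M : ℕ) :
    centreVisits M = (if M = 0 then 1 else 0) + visits (layerInd 1 M) / 3 := by
  rw [centreVisits, visits_eq_add (summable_stateInd _), avgStep_stateInd_zero, visits_smul]
  congr 1
  · simp [stateInd, Prod.ext_iff, eq_comm]
  · ring

lemma centreVisits_zero : centreVisits 0 = 1 := by
  rw [centreVisits_eq, layerInd_zero]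
  simp [visits, layerProb]

lemma occLimit_centre (r : ℕ) (hr : 0 < r) : occLimit (arrivalPos 1) r = centreVisits r := by
  rw [centreVisits_eq, if_neg hr.ne', visits_layerInd 1 r]
  ring

/-- There are `(a + b).choose a` paths from `(M, 0, 0)`, each of probability `3 ^ -(a + b)`. The
factor `3` removes the closing arrival at `0` counted in `pairWeight`. -/
lemma visits_stateInd (M a b : ℕ) :
    visits (stateInd (M, a, b)) = 3 * (centreVisits M * pairWeight (a, b)) := by
  suffices ∀ n a b, a + b = n →
      visits (stateInd (M, a, b)) = 3 * (centreVisits M * pairWeight (a, b)) from this _ a b rfl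
  intro n
  induction n with
  | zero =>
    intro a b h
    obtain ⟨rfl, rfl⟩ : a = 0 ∧ b = 0 := by omega
    norm_num [pairWeight, centreVisits]
    ring
  | succ n ih =>
    intro a b h
    have h0 : stateInd (M, a, b) 0 = 0 := by
      rw [stateInd, if_neg]
      simp only [Prod.ext_iff, Prod.fst_zero, Prod.snd_zero]
      omega
    rw [visits_eq_add (summable_stateInd _), h0, zero_add]
    rcases a with _ | a
    · rcases b with _ | b
      · omega
      · rw [avgStep_stateInd_zero_succ, visits_smul, ih 0 b (by omega)]
        simp only [pairWeight, zero_add, Nat.choose_zero_right, pow_succ]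
        field_simp
    · rcases b with _ | b
      · rw [avgStep_stateInd_succ_zero, visits_smul, ih a 0 (by omega)]
        simp only [pairWeight, add_zero, Nat.choose_self, pow_succ]
        field_simp
      · rw [avgStep_stateInd_succ_succ, visits_smul,
          visits_add (summable_stateInd _) (summable_stateInd _), ih (a + 1) b (by omega),
          ih a (b + 1) (by omega)]
        simp only [pairWeight]
        rw [show a + 1 + (b + 1) = a + b + 1 + 1 by ring, show a + 1 + b = a + b + 1 by ring,
          show a + (b + 1) = a + b + 1 by ring, Nat.choose_succ_succ (a + b + 1) a]
        push_cast
        field_simp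
        ring

lemma layerInd_centre (r : ℕ) :
    layerInd 1 (r + 1) = ∑ j ∈ Finset.range (r + 1), ∑ q ∈ maxFiber j,
      stateInd (r - j, q.1, q.2) := by
  funext t
  simp only [Finset.sum_apply, stateInd, layerInd]
  have hin : ∀ j, (∑ q ∈ maxFiber j, if t = (r - j, q.1, q.2) then (1 : ℝ) else 0) =
      if max t.2.1 t.2.2 = j ∧ t.1 = r - j then 1 else 0 := by
    intro j
    simp only [Prod.ext_iff]
    by_cases h : max t.2.1 t.2.2 = j ∧ t.1 = r - j
    · rw [if_pos h, Finset.sum_eq_single t.2]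
      · simp [h.2]
      · intro q _ hq
        rw [if_neg]
        rintro ⟨-, h1, h2⟩
        exact hq (Prod.ext h1.symm h2.symm)
      · exact fun h' => absurd (mem_maxFiber.2 h.1) h'
    · rw [if_neg h]
      refine Finset.sum_eq_zero fun q hq => if_neg ?_
      rintro ⟨h0, h1, h2⟩
      have := mem_maxFiber.1 hq
      exact h ⟨by rw [h1, h2, this], h0⟩
  simp only [hin]
  by_cases h : nextLayer 1 t = r + 1
  · have h' : t.1 + max t.2.1 t.2.2 + 1 = r + 1 := h
    rw [if_pos h, Finset.sum_eq_single (max t.2.1 t.2.2)]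
    · rw [if_pos ⟨rfl, by omega⟩]
    · intro j _ hj
      rw [if_neg]; exact fun h => hj h.1.symm
    · intro hj
      simp only [Finset.mem_range] at hj
      omega
  · rw [if_neg h]
    refine (Finset.sum_eq_zero fun j hj => if_neg ?_).symm
    rintro ⟨h1, h2⟩
    have h' : ¬ t.1 + max t.2.1 t.2.2 + 1 = r + 1 := h
    simp only [Finset.mem_range] at hj
    omega

/-- The renewal equation, by decomposition according to the layer `r - j` of the preceding particle
at `0`. -/
lemma centreVisits_succ (r : ℕ) :
    centreVisits (r + 1) = ∑ j ∈ Finset.range (r + 1), gapLaw j * centreVisits (r - j) := by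
  have hs : ∀ j, visits (∑ q ∈ maxFiber j, stateInd (r - j, q.1, q.2)) =
      3 * (gapLaw j * centreVisits (r - j)) := by
    intro j
    rw [visits_sum _ fun q _ => summable_stateInd _, gapLaw, Finset.sum_mul, Finset.mul_sum]
    refine Finset.sum_congr rfl fun q _ => ?_
    rw [visits_stateInd, mul_comm (centreVisits _)]
  rw [centreVisits_eq, if_neg (Nat.succ_ne_zero r), layerInd_centre, visits_sum]
  · simp only [hs, ← Finset.mul_sum]
    ring
  · intro j _
    have : layerProb (∑ q ∈ maxFiber j, stateInd (r - j, q.1, q.2)) =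
        fun n => ∑ q ∈ maxFiber j, layerProb (stateInd (r - j, q.1, q.2)) n :=
      funext fun n => layerProb_sum _ _ n
    rw [this]
    exact summable_sum fun q _ => summable_stateInd _

lemma tendsto_centreVisits : Tendsto centreVisits atTop (𝓝 ((10 - √5) / 19)) := by
  rw [← inv_gapMean]
  exact tendsto_renewal gapLaw_nonneg gapLaw_zero_pos hasSum_gapLaw hasSum_gapLaw_mean
    centreVisits_zero centreVisits_succ

/-- Arrivals at `-1` do not leave a row, and the next arrival at `0` or `1` is at either with
probability `1 / 2`. Summability permits solving the equation in which the row itself reappears. -/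
lemma visits_rowInd (M a : ℕ) : visits (rowInd M a) = 3 * (centreVisits M * (1 / 2) ^ (a + 1)) := by
  induction a with
  | zero =>
    have h := visits_eq_add (summable_rowInd M 0)
    have h0 : rowInd M 0 0 = if M = 0 then 1 else 0 := by simp [rowInd, eq_comm]
    rw [avgStep_rowInd_zero, visits_smul, visits_add (summable_rowInd M 0)
      (summable_layerProb (layerInd_nonneg 1 M) le_rfl), h0] at h
    rw [centreVisits_eq]
    norm_num
    linarith
  | succ a ih =>
    have h := visits_eq_add (summable_rowInd M (a + 1))
    have h0 : rowInd M (a + 1) 0 = 0 := by simp [rowInd]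
    rw [avgStep_rowInd_succ, visits_smul, visits_add (summable_rowInd M _) (summable_rowInd M a),
      h0, ih] at h
    rw [pow_succ]
    linarith

lemma layerInd_side (r : ℕ) :
    layerInd 2 (r + 1) = ∑ a ∈ Finset.range (r + 1), rowInd (r - a) a := by
  funext t
  simp only [Finset.sum_apply, rowInd, layerInd]
  by_cases h : nextLayer 2 t = r + 1
  · have h' : t.1 + t.2.1 + 1 = r + 1 := h
    rw [if_pos h, Finset.sum_eq_single t.2.1]
    · rw [if_pos ⟨by omega, rfl⟩]
    · intro j _ hj
      rw [if_neg]; exact fun h => hj h.2.symm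
    · intro hj
      simp only [Finset.mem_range] at hj
      omega
  · rw [if_neg h]
    refine (Finset.sum_eq_zero fun j hj => if_neg ?_).symm
    rintro ⟨h1, h2⟩
    have h' : ¬ t.1 + t.2.1 + 1 = r + 1 := h
    simp only [Finset.mem_range] at hj
    omega

lemma occLimit_side (r : ℕ) : occLimit (arrivalPos 2) (r + 1) =
    ∑ a ∈ Finset.range (r + 1), centreVisits (r - a) * (1 / 2) ^ (a + 1) := by
  have h := visits_layerInd 2 (r + 1)
  rw [layerInd_side, visits_sum _ fun a _ => summable_rowInd _ _] at h
  simp only [visits_rowInd, ← Finset.mul_sum] at h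
  linarith

lemma layerProb_layerInd_reflect (r n : ℕ) :
    layerProb (layerInd 0 r) n = layerProb (layerInd 2 r) n := by
  have key : ∀ (n : ℕ) (f : ℕ × ℕ × ℕ → ℝ) (s : ℕ × ℕ × ℕ),
      (avgStep layerStep ^ n) (fun t => f (t.1, t.2.2, t.2.1)) s =
        (avgStep layerStep ^ n) f (s.1, s.2.2, s.2.1) := by
    intro n
    induction n with
    | zero => intro f s; rfl
    | succ n ih =>
      intro f s
      simp only [pow_succ', Module.End.mul_apply, avgStep_apply, ih]
      simp [layerStep, max_comm]
      ring
  exact key n (layerInd 2 r) 0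

lemma occLimit_reflect (r : ℕ) :
    occLimit (arrivalPos 0) r = occLimit (arrivalPos 2) r := by
  have h : visits (layerInd 0 r) = visits (layerInd 2 r) :=
    tsum_congr fun n => layerProb_layerInd_reflect r n
  rw [visits_layerInd 0 r, visits_layerInd 2 r] at h
  linarith

lemma tendsto_occLimit_centre :
    Tendsto (occLimit (arrivalPos 1)) atTop (𝓝 ((10 - √5) / 19)) := by
  refine tendsto_centreVisits.congr' ?_
  filter_upwards [eventually_gt_atTop 0] with r hr
  exact (occLimit_centre r hr).symm

lemma tendsto_occLimit_right :
    Tendsto (occLimit (arrivalPos 2)) atTop (𝓝 ((10 - √5) / 19)) := by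
  rw [← tendsto_add_atTop_iff_nat 1]
  have hgeo : HasSum (fun a : ℕ => (1 / 2 : ℝ) ^ (a + 1)) 1 := by
    simpa [pow_succ] using hasSum_geometric_two.mul_right (1 / 2 : ℝ)
  -- The weights `(1 / 2) ^ (a + 1)` have total mass `1`, so averaging preserves the limit.
  have hlim := tendsto_tsum_of_dominated_convergence (𝓕 := atTop)
    (bound := fun a : ℕ => (1 / 2 : ℝ) ^ (a + 1))
    (f := fun r a => if a ∈ Finset.range (r + 1) then
      centreVisits (r - a) * (1 / 2) ^ (a + 1) else 0)
    (g := fun a => (10 - √5) / 19 * (1 / 2) ^ (a + 1)) hgeo.summable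
    (fun a => by
      refine ((tendsto_centreVisits.comp (tendsto_sub_atTop_nat a)).mul_const _).congr' ?_
      filter_upwards [eventually_ge_atTop a] with r hr
      rw [if_pos (Finset.mem_range.2 (by omega))]
      rfl)
    (Eventually.of_forall fun r a => by
      have hb := renewal_mem_Icc gapLaw_nonneg hasSum_gapLaw centreVisits_zero centreVisits_succ
        (r - a)
      split_ifs
      · rw [Real.norm_eq_abs, abs_of_nonneg (mul_nonneg hb.1 (by positivity))]
        exact mul_le_of_le_one_left (by positivity) hb.2
      · rw [norm_zero]; positivity)
  rw [(hgeo.mul_left _).tsum_eq, mul_one] at hlim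
  refine hlim.congr fun r => ?_
  rw [occLimit_side, tsum_eq_sum (s := Finset.range (r + 1)) (fun i hi => if_neg hi)]
  exact Finset.sum_congr rfl fun i hi => if_pos hi

lemma tendsto_occLimit_left :
    Tendsto (occLimit (arrivalPos 0)) atTop (𝓝 ((10 - √5) / 19)) :=
  tendsto_occLimit_right.congr fun r => (occLimit_reflect r).symm

end LayerChain

/-! ### From counting paths to the configuration chain. -/

section Paths

/-- Counting paths: they start at `0` and are nondecreasing and right-continuous. -/
structure IsCountingPath (n : Position → ℝ≥0 → ℕ) : Prop where
  zero : ∀ x, n x 0 = 0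
  mono : ∀ x, Monotone (n x)
  right : ∀ x t, ContinuousWithinAt (n x) (Set.Ici t) t

variable {n : Position → ℝ≥0 → ℕ}

lemma IsCountingPath.eq_of_totalArrivals_eq (hn : IsCountingPath n) {s t : ℝ≥0} (hst : s ≤ t)
    (h : totalArrivals n s = totalArrivals n t) (x : Position) : n x s = n x t :=
  (Finset.sum_eq_sum_iff_of_le fun x _ => hn.mono x hst).1 h x (Finset.mem_univ x)

lemma arrivalTime_le {k : ℕ} {t : ℝ≥0} (h : k ≤ totalArrivals n t) : arrivalTime n k ≤ t :=
  csInf_le (OrderBot.bddBelow _) h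

/-- An integer-valued right-continuous path is constant just after the infimum, so the infimum is
attained. -/
lemma IsCountingPath.le_totalArrivals_arrivalTime (hn : IsCountingPath n) {k : ℕ} {t : ℝ≥0}
    (h : k ≤ totalArrivals n t) : k ≤ totalArrivals n (arrivalTime n k) := by
  set s := arrivalTime n k with hs
  have hcont : ContinuousWithinAt (totalArrivals n) (Set.Ici s) s := by
    unfold totalArrivals
    exact tendsto_finsetSum _ fun x _ => hn.right x s
  have hev : ∀ᶠ t in 𝓝[Set.Ici s] s, totalArrivals n t = totalArrivals n s :=
    hcont (IsOpen.mem_nhds (isOpen_discrete {totalArrivals n s}) rfl)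
  obtain ⟨u, hu, hsub⟩ := (mem_nhdsGE_iff_exists_Ico_subset' (show s < s + 1 by simp)).1 hev
  obtain ⟨v, hv, hvu⟩ := exists_lt_of_csInf_lt (s := {t | k ≤ totalArrivals n t}) ⟨t, h⟩
    (show sInf _ < u from hu)
  have : totalArrivals n v = totalArrivals n s := hsub ⟨arrivalTime_le hv, hvu⟩
  exact this ▸ hv

lemma IsCountingPath.eq_arrivalTime (hn : IsCountingPath n) (t : ℝ≥0) (x : Position) :
    n x (arrivalTime n (totalArrivals n t)) = n x t := by
  have h1 := arrivalTime_le (le_refl (totalArrivals n t))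
  refine hn.eq_of_totalArrivals_eq h1 (le_antisymm ?_ ?_) x
  · exact Finset.sum_le_sum fun x _ => hn.mono x h1
  · exact hn.le_totalArrivals_arrivalTime le_rfl

lemma IsCountingPath.configAt_of_single_arrival (hn : IsCountingPath n) {s t : ℝ≥0} {x : Position}
    (h : ∀ y, n y t = n y s + if x = y then 1 else 0) :
    configAt n t = deposit (configAt n s) x := by
  have htot : totalArrivals n t = totalArrivals n s + 1 := by
    simp [totalArrivals, h, Finset.sum_add_distrib]
  unfold configAt
  have ht := hn.eq_arrivalTime t
  rw [htot] at ht ⊢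
  simp only [configAfter, ht, hn.eq_arrivalTime s, h]
  have hfil : (Finset.univ.filter fun y : Position => n y s < n y s + if x = y then 1 else 0) =
      {x} := by
    ext y
    by_cases hxy : x = y <;> simp [hxy, eq_comm]
  rw [hfil, Finset.image_singleton, deposit, Finset.insert_eq, Finset.union_comm]

lemma configAt_of_no_arrival {s t : ℝ≥0} (h : ∀ y, n y t = n y s) :
    configAt n t = configAt n s := by
  have htot : totalArrivals n t = totalArrivals n s := by
    simp [totalArrivals, h]
  rw [configAt, configAt, htot]

/-- The step of the configuration chain in a time slot with at most one arrival. -/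
def slotStep (o : Option (Fin 3)) (C : Configuration) : Configuration :=
  o.elim C fun i => configStep i C

/-- The configuration after time slots with the arrivals `c`. -/
def slotRun : ∀ m : ℕ, (Fin m → Option (Fin 3)) → Configuration
  | 0, _ => ∅
  | m + 1, c => slotStep (c (Fin.last m)) (slotRun m (Fin.init c))

lemma IsCountingPath.configAt_eq_slotRun (hn : IsCountingPath n) {t : ℕ → ℝ≥0} (ht0 : t 0 = 0)
    (m : ℕ) (c : Fin m → Option (Fin 3))
    (hc : ∀ (i : Fin m) (y : Position), n y (t (i + 1)) = n y (t i) +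
      if (c i).map arrivalPos = some y then 1 else 0) :
    configAt n (t m) = slotRun m c := by
  induction m with
  | zero =>
    have : totalArrivals n 0 = 0 := by simp [totalArrivals, hn.zero]
    rw [ht0, configAt, this]
    rfl
  | succ m ih =>
    have hlast := hc (Fin.last m)
    rw [Fin.val_last] at hlast
    rw [slotRun, ← ih (Fin.init c) fun i y => hc i.castSucc y]
    cases ho : c (Fin.last m) with
    | none =>
      rw [ho] at hlast
      exact configAt_of_no_arrival fun y => by simpa using hlast y
    | some i =>
      rw [ho] at hlast
      exact hn.configAt_of_single_arrival fun y => by simpa using hlast y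

/-- One slot acts as `α + 3 * β * P`, with `P` the averaging operator: no arrival has weight `α`,
each position has weight `β`. Independent slots multiply, and the binomial theorem then sorts by the
number of arrivals. -/
lemma sum_slotRun (α β : ℝ) (m : ℕ) (f : Configuration → ℝ) :
    ∑ c : Fin m → Option (Fin 3), (∏ i, (c i).elim α fun _ => β) * f (slotRun m c) =
      ((α • (1 : Module.End ℝ (Configuration → ℝ)) + (3 * β) • avgStep configStep) ^ m) f ∅ := by
  induction m generalizing f with
  | zero => simp [slotRun]
  | succ m ih =>
    rw [pow_succ, Module.End.mul_apply, ← ih,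
      ← (Fin.snocEquiv fun _ : Fin (m + 1) => Option (Fin 3)).sum_comp, Fintype.sum_prod_type_right]
    refine Finset.sum_congr rfl fun c _ => ?_
    have h : ∀ o : Option (Fin 3), (∏ i, ((Fin.snocEquiv fun _ : Fin (m + 1) => Option (Fin 3))
        (o, c) i).elim α fun _ => β) = (∏ i, (c i).elim α fun _ => β) * o.elim α fun _ => β := by
      intro o
      rw [Fin.prod_univ_castSucc]
      simp [Fin.snocEquiv]
    have h' : ∀ o : Option (Fin 3), slotRun (m + 1)
        ((Fin.snocEquiv fun _ : Fin (m + 1) => Option (Fin 3)) (o, c)) =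
          slotStep o (slotRun m c) := by
      intro o
      simp [slotRun, Fin.snocEquiv]
    simp only [h, h', mul_assoc, ← Finset.mul_sum]
    congr 1
    rw [Fintype.sum_option]
    simp only [Option.elim, slotStep, LinearMap.add_apply, LinearMap.smul_apply,
      Module.End.one_apply, Pi.add_apply, Pi.smul_apply, smul_eq_mul, avgStep_apply,
      Fin.sum_univ_three]
    ring

lemma sum_slotRun_eq_sum_choose (α β : ℝ) (m : ℕ) (x : Position) (r : ℕ) :
    ∑ c : Fin m → Option (Fin 3), (∏ i, (c i).elim α fun _ => β) * occInd x r (slotRun m c) =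
      ∑ k ∈ Finset.range (m + 1), (3 * β) ^ k * α ^ (m - k) * m.choose k * occProb x r k := by
  rw [sum_slotRun, add_comm, (((Commute.one_right _).smul_left _).smul_right _).add_pow]
  simp only [LinearMap.sum_apply, Finset.sum_apply]
  refine Finset.sum_congr rfl fun k _ => ?_
  rw [smul_pow, smul_pow, one_pow, ← Nat.cast_comm, ← nsmul_eq_mul, smul_mul_smul_comm, mul_one,
    ← Nat.cast_smul_eq_nsmul ℝ, smul_smul, LinearMap.smul_apply, Pi.smul_apply, smul_eq_mul, occProb]
  ring

end Paths

/-! ### Discretisation of time into slots. -/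

section SlotEvents

variable {Ω : Type*} {N : Position → ℝ≥0 → Ω → ℕ}

/-- The event that the arrivals in the consecutive time slots of length `h` are given by `c`. -/
def slotEvent (N : Position → ℝ≥0 → Ω → ℕ) (h : ℝ≥0) {m : ℕ} (c : Fin m → Option (Fin 3)) :
    Set Ω :=
  ⋂ j : Fin 3, ⋂ i : Fin m, {ω | N (arrivalPos j) (((i : ℕ) + 1 : ℕ) * h) ω -
    N (arrivalPos j) ((i : ℕ) * h) ω = if c i = some j then 1 else 0}

lemma disjoint_slotEvent {h : ℝ≥0} {m : ℕ} {c c' : Fin m → Option (Fin 3)} (hc : c ≠ c') :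
    Disjoint (slotEvent N h c) (slotEvent N h c') := by
  rw [Set.disjoint_left]
  intro ω h1 h2
  refine hc (funext fun i => ?_)
  have key : ∀ j, c i = some j ↔ c' i = some j := by
    intro j
    have e1 := Set.mem_iInter.1 (Set.mem_iInter.1 h1 j) i
    have e2 := Set.mem_iInter.1 (Set.mem_iInter.1 h2 j) i
    rw [Set.mem_ofPred_eq] at e1 e2
    rw [e1] at e2
    by_cases a : c i = some j <;> by_cases b : c' i = some j <;> simp_all
  exact Option.ext key

lemma IsCountingPath.configAt_of_mem_slotEvent {ω : Ω} {h : ℝ≥0} {m : ℕ}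
    {c : Fin m → Option (Fin 3)} (hn : IsCountingPath fun x t => N x t ω)
    (hb : ∀ x : Position, |(x : ℤ)| = 2 → ∀ t ω, N x t ω = 0)
    (hω : ω ∈ slotEvent N h c) :
    configAt (fun x t => N x t ω) (m * h) = slotRun m c := by
  refine hn.configAt_eq_slotRun (t := fun i : ℕ => (i : ℝ≥0) * h) (by simp) m c fun i y => ?_
  rcases abs_eq_two_or_exists_arrivalPos y with hy | ⟨j, rfl⟩
  · have : (c i).map arrivalPos ≠ some y := by
      intro he
      obtain ⟨j, -, rfl⟩ := Option.map_eq_some_iff.1 he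
      have := abs_arrivalPos_le j
      omega
    rw [if_neg this, hb y hy, hb y hy]
  · have e := Set.mem_iInter.1 (Set.mem_iInter.1 hω j) i
    rw [Set.mem_ofPred_eq] at e
    -- Monotonicity makes the truncated subtraction in `slotEvent` a true increment.
    have hm : N (arrivalPos j) ((i : ℕ) * h) ω ≤ N (arrivalPos j) (((i : ℕ) + 1 : ℕ) * h) ω :=
      hn.mono (arrivalPos j) (mul_le_mul_left (by exact_mod_cast Nat.le_succ _) h)
    have hiff : (c i).map arrivalPos = some (arrivalPos j) ↔ c i = some j := by
      rw [← Option.map_some]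
      exact (Option.map_injective arrivalPos_injective).eq_iff
    simp only [hiff]
    omega

/-- The event that the site `(x, r)` is occupied at time `t`. -/
def occEvent (N : Position → ℝ≥0 → Ω → ℕ) (t : ℝ≥0) (x : Position) (r : ℕ) : Set Ω :=
  {ω | (x, r) ∈ configAt (fun y s => N y s ω) t}

lemma occupancy_eq_indicator (t : ℝ≥0) (x : Position) (r : ℕ) :
    occupancy N t x r = (occEvent N t x r).indicator fun _ => (1 : ℝ) := by
  classical
  funext ω
  rw [Set.indicator_apply]
  exact if_congr Iff.rfl rfl rfl

end SlotEvents

/-! ### Probabilities of slot patterns. -/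

section ArrivalProcess

variable {Ω : Type*} [MeasurableSpace Ω] {μ : Measure Ω} {lam : ℝ≥0}
  {N : Position → ℝ≥0 → Ω → ℕ}

lemma IsArrivalProcess.ae_isCountingPath (hN : IsArrivalProcess N lam μ) :
    ∀ᵐ ω ∂μ, IsCountingPath fun x t => N x t ω := by
  have h : ∀ x : Position, ∀ᵐ ω ∂μ, N x 0 ω = 0 ∧ (Monotone fun t => N x t ω) ∧
      ∀ t, ContinuousWithinAt (fun s => N x s ω) (Set.Ici t) t := by
    intro x
    rcases abs_eq_two_or_exists_arrivalPos x with hx | ⟨i, rfl⟩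
    · refine Eventually.of_forall fun ω => ?_
      simp only [hN.boundary x hx]
      exact ⟨trivial, monotone_const, fun t => continuousWithinAt_const⟩
    · have hp := hN.poisson _ (abs_arrivalPos_le i)
      filter_upwards [hp.zero, hp.monotone, hp.right_continuous] with ω h1 h2 h3
      exact ⟨h1, h2, h3⟩
  filter_upwards [ae_all_iff.2 h] with ω hω
  exact ⟨fun x => (hω x).1, fun x => (hω x).2.1, fun x => (hω x).2.2⟩

lemma IsArrivalProcess.measurable (hN : IsArrivalProcess N lam μ) (j : Fin 3) (t : ℝ≥0) :
    Measurable (N (arrivalPos j) t) :=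
  (hN.poisson _ (abs_arrivalPos_le j)).measurable t

lemma IsArrivalProcess.measurableSet_slotEvent (hN : IsArrivalProcess N lam μ) (h : ℝ≥0) {m : ℕ}
    (c : Fin m → Option (Fin 3)) : MeasurableSet (slotEvent N h c) :=
  MeasurableSet.iInter fun j => MeasurableSet.iInter fun _ =>
    ((hN.measurable j _).sub (hN.measurable j _)) (measurableSet_singleton _)

lemma IsArrivalProcess.real_slotEvent [IsProbabilityMeasure μ] (hN : IsArrivalProcess N lam μ)
    (h : ℝ≥0) {m : ℕ} (c : Fin m → Option (Fin 3)) :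
    μ.real (slotEvent N h c) = ∏ i, (c i).elim (Real.exp (-(3 * lam * h)))
      fun _ => Real.exp (-(3 * lam * h)) * (lam * h) := by
  have hmono : Monotone fun i : ℕ => (i : ℝ≥0) * h := fun a b hab =>
    mul_le_mul_left (by exact_mod_cast hab) h
  have hind := hN.indep.precomp arrivalPos_injective
  have h1 : μ (slotEvent N h c) = ∏ j : Fin 3, μ (⋂ i : Fin m,
      {ω | N (arrivalPos j) (((i : ℕ) + 1 : ℕ) * h) ω - N (arrivalPos j) ((i : ℕ) * h) ω =
        if c i = some j then 1 else 0}) := by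
    refine hind.meas_iInter fun j => ?_
    refine ⟨⋂ i : Fin m, {p : ℝ≥0 → ℕ | p (((i : ℕ) + 1 : ℕ) * h) - p ((i : ℕ) * h) =
        if c i = some j then 1 else 0}, ?_, ?_⟩
    · refine MeasurableSet.iInter fun i => ?_
      have hm : Measurable fun p : ℝ≥0 → ℕ => p (((i : ℕ) + 1 : ℕ) * h) - p ((i : ℕ) * h) :=
        (measurable_pi_apply _).sub (measurable_pi_apply _)
      exact hm (measurableSet_singleton _)
    · ext ω; simp
  have h2 : ∀ j : Fin 3, μ (⋂ i : Fin m,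
      {ω | N (arrivalPos j) (((i : ℕ) + 1 : ℕ) * h) ω - N (arrivalPos j) ((i : ℕ) * h) ω =
        if c i = some j then 1 else 0}) =
      ∏ i : Fin m, poissonMeasure (lam * h) {if c i = some j then 1 else 0} := by
    intro j
    have hp := hN.poisson _ (abs_arrivalPos_le j)
    have hinc := (hp.indep_increments.nat hmono).precomp (Fin.val_injective (n := m))
    refine (hinc.meas_iInter fun i =>
      ⟨{if c i = some j then 1 else 0}, measurableSet_singleton _, rfl⟩).trans ?_
    refine Finset.prod_congr rfl fun i _ => ?_
    have hlaw := hp.law_increment _ _ (hmono (Nat.le_succ (i : ℕ)))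
    have hd : (((i : ℕ).succ : ℕ) : ℝ≥0) * h - ((i : ℕ) : ℝ≥0) * h = h := by
      rw [Nat.cast_succ, add_mul, one_mul, add_tsub_cancel_left]
    rw [hd] at hlaw
    rw [← hlaw.map_eq, Measure.map_apply_of_aemeasurable hlaw.aemeasurable
      (measurableSet_singleton _)]
  -- In one slot the three Poisson masses multiply to `exp (-3λh)`, with an extra `λh` if one
  -- arrival occurs.
  have hw : ∀ o : Option (Fin 3), ∏ j : Fin 3,
      (poissonMeasure (lam * h)).real {if o = some j then 1 else 0} =
        o.elim (Real.exp (-(3 * lam * h))) fun _ => Real.exp (-(3 * lam * h)) * (lam * h) := by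
    intro o
    have he : Real.exp (-(3 * lam * h)) = Real.exp (-(lam * h)) * Real.exp (-(lam * h)) *
        Real.exp (-(lam * h)) := by
      rw [← Real.exp_add, ← Real.exp_add]; ring_nf
    simp only [poissonMeasure_real_singleton, Fin.prod_univ_three]
    rcases o with _ | j
    · simp [he]
    · fin_cases j <;> simp [he] <;> ring
  rw [measureReal_def, h1]
  simp only [h2]
  rw [Finset.prod_comm, ENNReal.toReal_prod]
  refine Finset.prod_congr rfl fun i _ => ?_
  rw [ENNReal.toReal_prod, ← hw]
  rfl

end ArrivalProcess

/-! ### The limits of many slots and of large time. -/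

section Density

variable {Ω : Type*} [MeasurableSpace Ω] {μ : Measure Ω} {lam : ℝ≥0}
  {N : Position → ℝ≥0 → Ω → ℕ}

/-- The event that each of the `m` slots of length `h` sees at most one arrival. -/
def sparseEvent (N : Position → ℝ≥0 → Ω → ℕ) (h : ℝ≥0) (m : ℕ) : Set Ω :=
  ⋃ c : Fin m → Option (Fin 3), slotEvent N h c

/-- On the sparse event the slot pattern determines the configuration almost surely. This yields
both measurability and the probability. -/
lemma IsArrivalProcess.occEvent_inter_sparseEvent (hN : IsArrivalProcess N lam μ) (h : ℝ≥0) (m : ℕ)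
    (x : Position) (r : ℕ) :
    (occEvent N (m * h) x r ∩ sparseEvent N h m : Set Ω) =ᵐ[μ]
      ⋃ c ∈ Finset.univ.filter fun c : Fin m → Option (Fin 3) => (x, r) ∈ slotRun m c,
        slotEvent N h c := by
  filter_upwards [hN.ae_isCountingPath] with ω hω
  refine propext ⟨?_, ?_⟩
  · rintro ⟨h1, h2⟩
    obtain ⟨c, hc⟩ := Set.mem_iUnion.1 h2
    have h1' : (x, r) ∈ configAt (fun y s => N y s ω) (m * h) := h1
    rw [hω.configAt_of_mem_slotEvent hN.boundary hc] at h1'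
    exact Set.mem_biUnion (Finset.mem_coe.2 (Finset.mem_filter.2 ⟨Finset.mem_univ c, h1'⟩)) hc
  · intro h1
    obtain ⟨c, hc, hcω⟩ := Set.mem_iUnion₂.1 h1
    refine ⟨?_, Set.mem_iUnion.2 ⟨c, hcω⟩⟩
    have : configAt (fun y s => N y s ω) (m * h) = slotRun m c :=
      hω.configAt_of_mem_slotEvent hN.boundary hcω
    show (x, r) ∈ configAt (fun y s => N y s ω) (m * h)
    rw [this]
    exact (Finset.mem_filter.1 hc).2

lemma IsArrivalProcess.nullMeasurableSet_inter (hN : IsArrivalProcess N lam μ) (h : ℝ≥0) (m : ℕ)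
    (x : Position) (r : ℕ) :
    NullMeasurableSet (occEvent N (m * h) x r ∩ sparseEvent N h m) μ :=
  (Finset.measurableSet_biUnion _ fun c _ =>
    hN.measurableSet_slotEvent h c).nullMeasurableSet.congr
      (hN.occEvent_inter_sparseEvent h m x r).symm

variable [IsProbabilityMeasure μ]

lemma IsArrivalProcess.real_biUnion_slotEvent (hN : IsArrivalProcess N lam μ) (h : ℝ≥0) {m : ℕ}
    (s : Finset (Fin m → Option (Fin 3))) :
    μ.real (⋃ c ∈ s, slotEvent N h c) = ∑ c ∈ s, ∏ i, (c i).elim (Real.exp (-(3 * lam * h)))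
      fun _ => Real.exp (-(3 * lam * h)) * (lam * h) := by
  rw [measureReal_biUnion_finset (fun c _ c' _ hc => disjoint_slotEvent hc)
    fun c _ => hN.measurableSet_slotEvent h c]
  exact Finset.sum_congr rfl fun c _ => hN.real_slotEvent h c

lemma IsArrivalProcess.real_inter_sparseEvent (hN : IsArrivalProcess N lam μ) (h : ℝ≥0) (m : ℕ)
    (x : Position) (r : ℕ) :
    μ.real (occEvent N (m * h) x r ∩ sparseEvent N h m) =
      Real.exp (-(3 * lam * (m * h))) * ∑ k ∈ Finset.range (m + 1),
        (3 * lam * h : ℝ) ^ k * m.choose k * occProb x r k := by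
  rw [measureReal_congr (hN.occEvent_inter_sparseEvent h m x r), hN.real_biUnion_slotEvent,
    Finset.sum_filter]
  have := sum_slotRun_eq_sum_choose (Real.exp (-(3 * lam * h)))
    (Real.exp (-(3 * lam * h)) * (lam * h)) m x r
  simp only [occInd, mul_ite, mul_one, mul_zero] at this
  rw [this, Finset.mul_sum]
  refine Finset.sum_congr rfl fun k hk => ?_
  have he : Real.exp (-(3 * lam * (m * h))) =
      Real.exp (-(3 * lam * h)) ^ k * Real.exp (-(3 * lam * h)) ^ (m - k) := by
    rw [← pow_add, Nat.add_sub_cancel' (by simpa [Nat.lt_succ_iff] using hk), ← Real.exp_nat_mul]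
    ring_nf
  rw [he, mul_left_comm, mul_pow]
  ring

lemma IsArrivalProcess.real_sparseEvent (hN : IsArrivalProcess N lam μ) (h : ℝ≥0) (m : ℕ) :
    μ.real (sparseEvent N h m) =
      Real.exp (-(3 * lam * (m * h))) * (1 + 3 * lam * h : ℝ) ^ m := by
  have hu : sparseEvent N h m = ⋃ c ∈ (Finset.univ : Finset (Fin m → Option (Fin 3))),
      slotEvent N h c := by simp [sparseEvent]
  rw [hu, hN.real_biUnion_slotEvent]
  have hp := Fintype.prod_sum fun (_ : Fin m) (o : Option (Fin 3)) =>
    o.elim (Real.exp (-(3 * lam * h))) fun _ => Real.exp (-(3 * lam * h)) * (lam * h)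
  rw [← hp]
  simp only [Fintype.sum_option, Option.elim, Finset.sum_const, Finset.prod_const,
    Finset.card_univ, Fintype.card_fin, nsmul_eq_mul]
  rw [show -(3 * (lam : ℝ) * (m * h)) = m * -(3 * lam * h) by ring, Real.exp_nat_mul, ← mul_pow]
  congr 1
  push_cast
  ring

/-- The approximation of the exponential function in the Poisson limit. -/
lemma tendsto_exp_neg_mul_one_add_div_pow (s : ℝ) :
    Tendsto (fun m : ℕ => Real.exp (-s) * (1 + s / m) ^ m) atTop (𝓝 1) := by
  simpa [← Real.exp_add] using (Real.tendsto_one_add_div_pow_exp s).const_mul (Real.exp (-s))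

lemma mul_div_cancel_slots (t : ℝ≥0) {m : ℕ} (hm : 0 < m) : (m : ℝ≥0) * (t / m) = t :=
  mul_div_cancel₀ t (by exact_mod_cast hm.ne')

lemma IsArrivalProcess.tendsto_real_sparseEvent (hN : IsArrivalProcess N lam μ) (t : ℝ≥0) :
    Tendsto (fun m : ℕ => μ.real (sparseEvent N (t / m) m)) atTop (𝓝 1) := by
  refine (tendsto_exp_neg_mul_one_add_div_pow (3 * lam * t)).congr' ?_
  filter_upwards [eventually_gt_atTop 0] with m hm
  have hm' : (m : ℝ) ≠ 0 := by exact_mod_cast hm.ne'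
  rw [hN.real_sparseEvent]
  push_cast
  rw [mul_div_cancel₀ _ hm', mul_div_assoc]

/-- The sparse events have probabilities tending to `1`, so their union is almost everything; on
each one the event is null measurable. -/
lemma IsArrivalProcess.nullMeasurableSet_occEvent (hN : IsArrivalProcess N lam μ) (t : ℝ≥0)
    (x : Position) (r : ℕ) : NullMeasurableSet (occEvent N t x r) μ := by
  set G : ℕ → Set Ω := fun m => sparseEvent N (t / (m + 1 : ℕ)) (m + 1) with hG
  have hGm : ∀ m, MeasurableSet (G m) := fun m =>
    MeasurableSet.iUnion fun c => hN.measurableSet_slotEvent _ c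
  have hU : μ (⋃ m, G m) = 1 := by
    refine le_antisymm prob_le_one ?_
    have hlim := (tendsto_add_atTop_iff_nat 1).2 (hN.tendsto_real_sparseEvent t)
    have h1 : (1 : ℝ) ≤ μ.real (⋃ m, G m) :=
      le_of_tendsto' hlim fun m => measureReal_mono (Set.subset_iUnion G m)
    rw [measureReal_def] at h1
    exact (ENNReal.one_le_ofReal.2 h1).trans_eq (ENNReal.ofReal_toReal (measure_ne_top _ _))
  have hae : ∀ᵐ ω ∂μ, ω ∈ ⋃ m, G m :=
    (prob_compl_eq_zero_iff (MeasurableSet.iUnion hGm)).2 hU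
  have hA : NullMeasurableSet (⋃ m, occEvent N t x r ∩ G m) μ := by
    refine NullMeasurableSet.iUnion fun m => ?_
    have := hN.nullMeasurableSet_inter (t / (m + 1 : ℕ)) (m + 1) x r
    rwa [mul_div_cancel_slots t m.succ_pos] at this
  refine hA.congr ?_
  rw [← Set.inter_iUnion]
  filter_upwards [hae] with ω hω
  exact propext (and_iff_left hω)

lemma sum_pow_div_mul_choose (s : ℝ) (m : ℕ) :
    ∑ k ∈ Finset.range (m + 1), (s / m) ^ k * m.choose k = (1 + s / m) ^ m := by
  rw [add_comm 1, add_pow]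
  simp

lemma pow_div_mul_choose_le {s : ℝ} (hs : 0 ≤ s) {m : ℕ} (hm : 0 < m) (k : ℕ) :
    (s / m) ^ k * m.choose k ≤ s ^ k := by
  have hm' : (0 : ℝ) < m := by exact_mod_cast hm
  have hc : (m.choose k : ℝ) ≤ (m : ℝ) ^ k := by exact_mod_cast Nat.choose_le_pow m k
  calc (s / m) ^ k * m.choose k ≤ (s / m) ^ k * (m : ℝ) ^ k := by gcongr
    _ = s ^ k := by rw [← mul_pow, div_mul_cancel₀ _ hm'.ne']

lemma IsArrivalProcess.real_inter_sparseEvent_div (hN : IsArrivalProcess N lam μ) (t : ℝ≥0) {m : ℕ}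
    (hm : 0 < m) (x : Position) (r : ℕ) :
    μ.real (occEvent N t x r ∩ sparseEvent N (t / m) m) =
      Real.exp (-(3 * lam * t)) * ∑ k ∈ Finset.range (m + 1),
        (3 * lam * t / m : ℝ) ^ k * m.choose k * occProb x r k := by
  have hm' : (m : ℝ) ≠ 0 := by exact_mod_cast hm.ne'
  have h := hN.real_inter_sparseEvent (t / m) m x r
  rw [mul_div_cancel_slots t hm] at h
  rw [h]
  push_cast
  rw [mul_div_cancel₀ _ hm', mul_div_assoc]

/-- The non-sparse part has vanishing mass as `m → ∞`; on the sparse part every `occProb` is at most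
its supremum. -/
lemma IsArrivalProcess.real_occEvent_le (hN : IsArrivalProcess N lam μ) (t : ℝ≥0)
    (x : Position) (r : ℕ) : μ.real (occEvent N t x r) ≤ occLimit x r := by
  set s : ℝ := 3 * lam * t with hs
  have hs0 : 0 ≤ s := by positivity
  have hlim := ((tendsto_exp_neg_mul_one_add_div_pow s).mul_const (occLimit x r)).add
    ((hN.tendsto_real_sparseEvent t).const_sub 1)
  rw [one_mul, sub_self, add_zero] at hlim
  refine ge_of_tendsto hlim ?_
  filter_upwards [eventually_gt_atTop 0] with m hm
  have hG : MeasurableSet (sparseEvent N (t / m) m) :=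
    MeasurableSet.iUnion fun c => hN.measurableSet_slotEvent _ c
  have h1 : μ.real (occEvent N t x r) ≤ μ.real (occEvent N t x r ∩ sparseEvent N (t / m) m) +
      μ.real (sparseEvent N (t / m) m)ᶜ := by
    refine (measureReal_mono ?_).trans (measureReal_union_le _ _)
    intro ω hω
    by_cases h : ω ∈ sparseEvent N (t / m) m
    · exact Or.inl ⟨hω, h⟩
    · exact Or.inr h
  rw [probReal_compl_eq_one_sub hG] at h1
  refine h1.trans (add_le_add_left ?_ _)
  rw [hN.real_inter_sparseEvent_div t hm, ← hs, mul_assoc (Real.exp (-s)), ← sum_pow_div_mul_choose,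
    Finset.sum_mul]
  gcongr with k
  exact occProb_le_occLimit x r k

/-- Discard the patterns with fewer than `K` arrivals and use monotonicity of `occProb` for the
others. Bounding the discarded weights by `s ^ k`, without the factorial, suffices because `exp
(-s)` beats any polynomial. -/
lemma IsArrivalProcess.le_real_occEvent (hN : IsArrivalProcess N lam μ) (t : ℝ≥0)
    (x : Position) (r K : ℕ) :
    (1 - Real.exp (-(3 * lam * t)) * ∑ k ∈ Finset.range K, (3 * lam * t : ℝ) ^ k) *
      occProb x r K ≤ μ.real (occEvent N t x r) := by
  set s : ℝ := 3 * lam * t with hs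
  have hs0 : 0 ≤ s := by positivity
  have hlim := ((tendsto_exp_neg_mul_one_add_div_pow s).sub_const
    (Real.exp (-s) * ∑ k ∈ Finset.range K, s ^ k)).mul_const (occProb x r K)
  refine le_of_tendsto hlim ?_
  filter_upwards [eventually_gt_atTop 0] with m hm
  refine le_trans ?_ (measureReal_mono (Set.inter_subset_left (t := sparseEvent N (t / m) m)))
  rw [hN.real_inter_sparseEvent_div t hm, ← mul_sub, mul_assoc]
  refine mul_le_mul_of_nonneg_left ?_ (Real.exp_nonneg _)
  have hw : ∀ k, 0 ≤ (s / m) ^ k * m.choose k := fun k => by positivity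
  have h1 : ∑ k ∈ Finset.range (m + 1), (if k < K then (s / m) ^ k * m.choose k else 0) ≤
      ∑ k ∈ Finset.range K, s ^ k := by
    rw [← Finset.sum_filter]
    calc _ ≤ ∑ k ∈ Finset.range K, (s / m) ^ k * m.choose k :=
          Finset.sum_le_sum_of_subset_of_nonneg
            (fun k hk => Finset.mem_range.2 (Finset.mem_filter.1 hk).2) fun k _ _ => hw k
      _ ≤ _ := Finset.sum_le_sum fun k _ => pow_div_mul_choose_le hs0 hm k
  calc _ ≤ ((1 + s / m) ^ m -
        ∑ k ∈ Finset.range (m + 1), (if k < K then (s / m) ^ k * m.choose k else 0)) *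
          occProb x r K := by
        have := occProb_nonneg x r K
        gcongr
    _ ≤ _ := by
        rw [← sum_pow_div_mul_choose, ← Finset.sum_sub_distrib, Finset.sum_mul]
        refine Finset.sum_le_sum fun k _ => ?_
        split_ifs with hk
        · rw [sub_self, zero_mul]
          exact mul_nonneg (hw k) (occProb_nonneg x r k)
        · rw [sub_zero]
          exact mul_le_mul_of_nonneg_left (occProb_mono x r (not_lt.1 hk)) (hw k)

lemma IsArrivalProcess.tendsto_real_occEvent (hN : IsArrivalProcess N lam μ) (hlam : 0 < lam)
    (x : Position) (r : ℕ) :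
    Tendsto (fun t => μ.real (occEvent N t x r)) atTop (𝓝 (occLimit x r)) := by
  refine tendsto_order.2 ⟨fun a ha => ?_, fun a ha =>
    Eventually.of_forall fun t => (hN.real_occEvent_le t x r).trans_lt ha⟩
  obtain ⟨K, hK⟩ := ((tendsto_occProb x r).eventually (lt_mem_nhds ha)).exists
  have hs : Tendsto (fun t : ℝ≥0 => (3 * lam * t : ℝ)) atTop atTop :=
    (NNReal.tendsto_coe_atTop.2 tendsto_id).const_mul_atTop (by positivity)
  have hpoly : Tendsto (fun s : ℝ => Real.exp (-s) * ∑ k ∈ Finset.range K, s ^ k) atTop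
      (𝓝 0) := by
    simp only [Finset.mul_sum]
    have := tendsto_finsetSum (Finset.range K) fun k _ =>
      Real.tendsto_pow_mul_exp_neg_atTop_nhds_zero k
    simpa [mul_comm] using this
  have hlim := ((hpoly.comp hs).const_sub 1).mul_const (occProb x r K)
  rw [sub_zero, one_mul] at hlim
  filter_upwards [hlim.eventually (lt_mem_nhds hK)] with t ht
  exact ht.trans_le (hN.le_real_occEvent t x r K)

lemma IsArrivalProcess.integrable_occupancy (hN : IsArrivalProcess N lam μ) (t : ℝ≥0)
    (x : Position) (r : ℕ) : Integrable (occupancy N t x r) μ := by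
  rw [occupancy_eq_indicator]
  exact (integrable_const (1 : ℝ)).indicator₀ (hN.nullMeasurableSet_occEvent t x r)

lemma IsArrivalProcess.density_eq (hN : IsArrivalProcess N lam μ) (t : ℝ≥0)
    (x : Position) (r : ℕ) : density N μ t x r = μ.real (occEvent N t x r) := by
  rw [density, occupancy_eq_indicator, integral_indicator₀ (hN.nullMeasurableSet_occEvent t x r)]
  simp

end Density

theorem theorem2 {Ω : Type*} [MeasurableSpace Ω] (μ : Measure Ω) [IsProbabilityMeasure μ]
    (lam : ℝ≥0) (hlam : 0 < lam) (N : Position → ℝ≥0 → Ω → ℕ)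
    (hN : IsArrivalProcess N lam μ) :
    (∀ t x r, Integrable (occupancy N t x r) μ) ∧
    (∃ ρ : Position → ℕ → ℝ,
      (∀ x r, Tendsto (fun t : ℝ≥0 => density N μ t x r) atTop (𝓝 (ρ x r))) ∧
      (∀ x : Position, (x : ℤ) = 0 →
        Tendsto (fun r => ρ x r) atTop (𝓝 ((10 - √5) / 19))) ∧
      (∀ x : Position, (x : ℤ) = -1 ∨ (x : ℤ) = 1 →
        Tendsto (fun r => ρ x r) atTop (𝓝 ((10 - √5) / 19)))) ∧
    |(10 - √5) / 19 - (0.408628 : ℝ)| < 5 * (10 : ℝ)⁻¹ ^ 7 := by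
  refine ⟨hN.integrable_occupancy, ⟨occLimit, fun x r => ?_, fun x hx => ?_, fun x hx => ?_⟩, ?_⟩
  · simp only [hN.density_eq]
    exact hN.tendsto_real_occEvent hlam x r
  · obtain rfl : x = arrivalPos 1 := Subtype.ext (by simpa [arrivalPos] using hx)
    exact tendsto_occLimit_centre
  · rcases hx with hx | hx
    · obtain rfl : x = arrivalPos 0 := Subtype.ext (by simpa [arrivalPos] using hx)
      exact tendsto_occLimit_left
    · obtain rfl : x = arrivalPos 2 := Subtype.ext (by simpa [arrivalPos] using hx)
      exact tendsto_occLimit_right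
  · have h1 : 2.23606 < √5 := Real.lt_sqrt_of_sq_lt (by norm_num)
    have h2 : √5 < 2.23607 := (Real.sqrt_lt' (by norm_num)).2 (by norm_num)
    rw [abs_lt]
    constructor <;> norm_num at h1 h2 ⊢ <;> linarith
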